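/- Let $(T,m)$ be a probability space and let $(\psi_n)_{n\ge 1}$ be a bounded sequence in the complex space $L_\infty(T,m)$. Let $(g_n)$ be an i.i.d. sequence of standard complex Gaussian random variables on some probability space, i.e. each $g_n$ is distributed as $2^{-1/2}(g'+ig'')$ with $g',g''$ independent standard real Gaussians. Call $(\psi_n)$ *randomly Sidon* if there is a constant $C$ such that $\sum_n|a_n|\le C\,\mathbb E\,\|\sum_n g_na_n\psi_n\|_{L_\infty(T,m)}$ for every finitely supported complex sequence $(a_n)$. For $k\ge 1$ call $(\psi_n)$ *$\otimes^k$-Sidon* if there is a constant $\alpha$ such that $$\sum_n|a_n|\le\alpha\,\Big\|\sum_n a_n\psi_n(t_1)\psi_n(t_2)\cdots\psi_n(t_k)\Big\|_{L_\infty(T^k,m^{\otimes k})}$$ for every finitely supported complex sequence $(a_n)$. Suppose that there is another bounded sequence $(\varphi_n)$ in $L_\infty(T,m)$ such that $\int\psi_n\overline{\varphi_k}\,dm=\delta_{n,k}$ for all $n,k$. Then the following are equivalent: (i) $(\psi_n)$ is randomly Sidon; (ii) $(\psi_n)$ is $\otimes^4$-Sidon; (iii) $(\psi_n)$ is $\otimes^k$-Sidon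 for some $k\ge4$; (iv) $(\psi_n)$ is $\otimes^k$-Sidon for all $k\ge4$. In particular, this equivalence holds when $(\psi_n)$ is a uniformly bounded orthonormal system in $L_2(T,m)$. -/

import Mathlib

open MeasureTheory ProbabilityTheory
open scoped ENNReal NNReal ComplexConjugate

namespace SidonSystems

/-- The standard complex Gaussian law: the law of `2^{-1/2} (g' + i g'')` where `g'`, `g''` are
independent standard real Gaussian variables. -/
noncomputable def stdComplexGaussian : Measure ℂ :=
  ((gaussianReal 0 1).prod (gaussianReal 0 1)).map
    (fun p : ℝ × ℝ => (((Real.sqrt 2)⁻¹ : ℝ) : ℂ) * ((p.1 : ℂ) + (p.2 : ℂ) * Complex.I))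

/-- `(g n)` is an i.i.d. sequence of standard complex Gaussian variables on `(Ω, P)`. -/
structure IsComplexGaussianSequence {Ω : Type*} [MeasurableSpace Ω] (P : Measure Ω)
    (g : ℕ → Ω → ℂ) : Prop where
  hasLaw : ∀ n, HasLaw (g n) stdComplexGaussian P
  indep : iIndepFun g P

/-- `(ψ n)` is a bounded sequence in `L_∞(T, m)`. -/
def BoundedInLinfty {T : Type*} [MeasurableSpace T] (m : Measure T) (ψ : ℕ → T → ℂ) : Prop :=
  (∀ n, AEStronglyMeasurable (ψ n) m) ∧ ∃ C : ℝ≥0, ∀ n, eLpNorm (ψ n) ∞ m ≤ C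

/-- `∫ ψ_n conj(φ_k) dm = δ_{n,k}` for all `n`, `k`. -/
def Biorthogonal {T : Type*} [MeasurableSpace T] (m : Measure T) (ψ φ : ℕ → T → ℂ) : Prop :=
  ∀ n k, ∫ t, ψ n t * conj (φ k t) ∂m = if n = k then 1 else 0

/-- `(ψ n)` is an orthonormal system in `L_2(T, m)`. -/
def OrthonormalSystem {T : Type*} [MeasurableSpace T] (m : Measure T) (ψ : ℕ → T → ℂ) : Prop :=
  (∀ n, MemLp (ψ n) 2 m) ∧ ∀ n k, ∫ t, ψ n t * conj (ψ k t) ∂m = if n = k then 1 else 0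

/-- `(ψ n)` is Sidon: `∑ |a_n| ≤ α ‖∑ a_n ψ_n‖_∞` for all finitely supported `a`, with the
norm of `L_∞(T, m)`. -/
def Sidon {T : Type*} [MeasurableSpace T] (m : Measure T) (ψ : ℕ → T → ℂ) : Prop :=
  ∃ α : ℝ≥0, ∀ (s : Finset ℕ) (a : ℕ → ℂ),
    ∑ n ∈ s, ‖a n‖ₑ ≤ α * eLpNorm (fun t => ∑ n ∈ s, a n * ψ n t) ∞ m

/-- The function `ψ ⊗ ⋯ ⊗ ψ` (`k` factors) on `T^k`: `(t_1, …, t_k) ↦ ψ(t_1) ⋯ ψ(t_k)`. -/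
def tensorPower {T : Type*} (k : ℕ) (ψ : T → ℂ) : (Fin k → T) → ℂ :=
  fun t => ∏ j, ψ (t j)

/-- `(ψ n)` is `⊗^k`-Sidon: the system `(ψ n ⊗ ⋯ ⊗ ψ n)` is Sidon on `(T, m)^k`. -/
def TensorSidon {T : Type*} [MeasurableSpace T] (m : Measure T) (k : ℕ) (ψ : ℕ → T → ℂ) : Prop :=
  Sidon (Measure.pi (fun _ : Fin k => m)) (fun n => tensorPower k (ψ n))

/-- `(ψ n)` is randomly Sidon with respect to the random coefficients `(g n)`:
`∑ |a_n| ≤ C 𝔼 ‖∑ g_n a_n ψ_n‖_∞` for all finitely supported `a`. -/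
def RandomlySidon {Ω : Type*} [MeasurableSpace Ω] (P : Measure Ω) (g : ℕ → Ω → ℂ)
    {T : Type*} [MeasurableSpace T] (m : Measure T) (ψ : ℕ → T → ℂ) : Prop :=
  ∃ C : ℝ≥0, ∀ (s : Finset ℕ) (a : ℕ → ℂ),
    ∑ n ∈ s, ‖a n‖ₑ ≤
      C * ∫⁻ ω, eLpNorm (fun t => ∑ n ∈ s, g n ω * a n * ψ n t) ∞ m ∂P

end SidonSystems

/-! All implications pass through `RademacherSidon`, the randomly Sidon inequality with independent
signs in place of Gaussians; on a finite set of indices it is an average over the group of sign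
vectors. Signs and Gaussians give equivalent notions. Symmetry of the Gaussian law and conditioning
on the Gaussian values give one direction. Truncating the Gaussians at a high level and absorbing
the tail gives the other.

Tensor Sidon implies random for every positive number of factors and without biorthogonality.
Multiplication of bounded families is Lipschitz after polarization, so the comparison principle for
Rademacher processes bounds the expected supremum of the product process by that of a single factor
(`RadBound.prod`). The Sidon inequality bounds the product process below for every choice of signs.

For the converse, let N be the number of sign vectors. Hahn–Banach turns the sign inequality into
functions f_ε of L1 norm O(1/N) with ∑ ε_n ⟨f_ε, ψ_n⟩ close to 1 for each n (`exists_dual_system`).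
The coefficients of ε_l against ψ_n with l ≠ n are uncontrolled. Convolving f with a Riesz product
kernel whose first order coefficients are the conjugates of φ_n, placed on further tensor factors,
makes the coefficient matrix exactly diagonal (`exists_isDualSystem_prod`).

Two such systems, on disjoint groups of factors, would recover ∑ w_n a_n for any signs w if paired
through the kernel ∑ w_n ε_n η_n, but the L1 norm of that kernel is not bounded uniformly in the
number of indices. It is replaced by `oddKernel`, of mean absolute value at most 1/δ, whose
remaining Walsh coefficients are at most δ². By Parseval the remainder is a small bilinear form,
absorbed for small δ (`IsDualSystem.norm_sum_signs_le`). Each system needs one factor for f and at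
least one for φ, whence four factors. -/

namespace SidonSystems

/-! ### Riesz products and multipliers on the sign group -/

section Signs

variable {ι : Type*}

/-- The `n`-th Rademacher function on the finite sign group `ι → ℤˣ`. -/
def rad (ε : ι → ℤˣ) (n : ι) : ℝ := ((ε n : ℤ) : ℝ)

lemma rad_mul (ε η : ι → ℤˣ) (n : ι) : rad (ε * η) n = rad ε n * rad η n := by
  simp [rad]

@[simp] lemma rad_one (n : ι) : rad (1 : ι → ℤˣ) n = 1 := by simp [rad]

lemma rad_eq_one_or (ε : ι → ℤˣ) (n : ι) : rad ε n = 1 ∨ rad ε n = -1 := by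
  rcases Int.units_eq_one_or (ε n) with h | h <;> simp [rad, h]

@[simp] lemma abs_rad (ε : ι → ℤˣ) (n : ι) : |rad ε n| = 1 := by
  rcases rad_eq_one_or ε n with h | h <;> simp [h]

@[simp] lemma rad_mul_self (ε : ι → ℤˣ) (n : ι) : rad ε n * rad ε n = 1 := by
  rcases rad_eq_one_or ε n with h | h <;> simp [h]

lemma mul_self_signs (ε : ι → ℤˣ) : ε * ε = 1 := by
  funext n; simp

variable [Fintype ι]

/-- The Riesz product `∏ (1 + c_n η_n)`. -/
def riesz (c : ι → ℝ) (η : ι → ℤˣ) : ℝ := ∏ n, (1 + c n * rad η n)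

lemma riesz_nonneg {c : ι → ℝ} (hc : ∀ n, |c n| ≤ 1) (η : ι → ℤˣ) : 0 ≤ riesz c η := by
  refine Finset.prod_nonneg fun n _ => ?_
  have := abs_le.1 (hc n)
  rcases rad_eq_one_or η n with h | h <;> rw [h] <;> linarith

variable [DecidableEq ι]

lemma card_signs : (Fintype.card (ι → ℤˣ) : ℝ) = 2 ^ Fintype.card ι := by
  simp

lemma sum_mul_left_signs {M : Type*} [AddCommMonoid M] (ε : ι → ℤˣ) (f : (ι → ℤˣ) → M) :
    ∑ η, f (ε * η) = ∑ η, f η :=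
  Fintype.sum_equiv (Equiv.mulLeft ε) _ _ fun _ => rfl

lemma sum_units (f : ℤˣ → ℝ) : ∑ u, f u = f 1 + f (-1) := by
  rw [UnitsInt.univ, Finset.sum_pair (by decide)]

lemma sum_prod_signs (q : ι → ℤˣ → ℝ) :
    ∑ η : ι → ℤˣ, ∏ n, q n (η n) = ∏ n, (q n 1 + q n (-1)) := by
  simp_rw [← sum_units]
  rw [Finset.prod_univ_sum, Fintype.piFinset_univ]

lemma sum_riesz (c : ι → ℝ) : ∑ η : ι → ℤˣ, riesz c η = Fintype.card (ι → ℤˣ) := by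
  have := sum_prod_signs (fun n u => 1 + c n * ((u : ℤ) : ℝ))
  simp only [riesz, rad]
  rw [this, card_signs]
  simp only [Units.val_one, Int.cast_one, Units.val_neg, Int.cast_neg]
  rw [← Finset.card_univ, ← Finset.prod_const]
  exact Finset.prod_congr rfl fun n _ => by ring

/-- In the mean the coordinates are independent and only (1 + c_n η_n) η_n contributes a nontrivial
factor, namely c_n. Thus bounded multipliers are averages of sign changes. -/
lemma sum_riesz_mul_rad (c : ι → ℝ) (n : ι) :
    ∑ η : ι → ℤˣ, riesz c η * rad η n = Fintype.card (ι → ℤˣ) * c n := by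
  have := sum_prod_signs
    (fun k u => (1 + c k * ((u : ℤ) : ℝ)) * if k = n then ((u : ℤ) : ℝ) else 1)
  simp only [Finset.prod_mul_distrib, Finset.prod_ite_eq', Finset.mem_univ, if_true] at this
  simp only [riesz, rad]
  rw [this, card_signs]
  have h2 : ∀ k, ((1 + c k * (((1 : ℤˣ) : ℤ) : ℝ)) * (if k = n then (((1 : ℤˣ) : ℤ) : ℝ) else 1) +
      (1 + c k * (((-1 : ℤˣ) : ℤ) : ℝ)) * (if k = n then (((-1 : ℤˣ) : ℤ) : ℝ) else 1)) =
      2 * if k = n then c k else 1 := by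
    intro k
    split_ifs <;> simp <;> ring
  simp_rw [h2, Finset.prod_mul_distrib]
  simp

/-- Rademacher contraction principle for real multipliers. -/
lemma contraction_real {E : Type*} [NormedAddCommGroup E] [NormedSpace ℝ E] (x : ι → E)
    {c : ι → ℝ} (hc : ∀ n, |c n| ≤ 1) :
    ∑ ε : ι → ℤˣ, ‖∑ n, (rad ε n * c n) • x n‖ ≤ ∑ ε : ι → ℤˣ, ‖∑ n, rad ε n • x n‖ := by
  set N : ℝ := (Fintype.card (ι → ℤˣ) : ℝ) with hN
  have hNpos : 0 < N := by rw [hN]; exact_mod_cast Fintype.card_pos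
  have key : ∀ ε : ι → ℤˣ, N * ‖∑ n, (rad ε n * c n) • x n‖ ≤
      ∑ η, riesz c η * ‖∑ n, rad (η * ε) n • x n‖ := by
    intro ε
    -- The multiplier c is written as an average of sign changes η with nonnegative weights;
    -- translation invariance in ε then removes η.
    have h1 : N • ∑ n, (rad ε n * c n) • x n =
        ∑ η, riesz c η • ∑ n, rad (η * ε) n • x n := by
      simp_rw [Finset.smul_sum]
      rw [Finset.sum_comm]
      refine Finset.sum_congr rfl fun n _ => ?_
      simp_rw [smul_smul, ← Finset.sum_smul, rad_mul]
      congr 1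
      simp_rw [← mul_assoc, ← Finset.sum_mul, sum_riesz_mul_rad]
      ring
    calc N * ‖∑ n, (rad ε n * c n) • x n‖ = ‖N • ∑ n, (rad ε n * c n) • x n‖ := by
          rw [norm_smul, Real.norm_of_nonneg hNpos.le]
      _ ≤ _ := by
          rw [h1]
          refine (norm_sum_le _ _).trans (Finset.sum_le_sum fun η _ => ?_)
          rw [norm_smul, Real.norm_of_nonneg (riesz_nonneg hc η)]
  refine le_of_mul_le_mul_left ?_ hNpos
  rw [Finset.mul_sum]
  refine (Finset.sum_le_sum fun ε _ => key ε).trans_eq ?_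
  rw [Finset.sum_comm]
  simp_rw [← Finset.mul_sum]
  have h2 : ∀ η : ι → ℤˣ, ∑ ε : ι → ℤˣ, ‖∑ n, rad (η * ε) n • x n‖ =
      ∑ ε : ι → ℤˣ, ‖∑ n, rad ε n • x n‖ :=
    fun η => sum_mul_left_signs η fun ε => ‖∑ n, rad ε n • x n‖
  simp_rw [h2]
  rw [← Finset.sum_mul, sum_riesz]

/-- Rademacher contraction principle for complex multipliers. -/
lemma contraction_complex {E : Type*} [NormedAddCommGroup E] [NormedSpace ℂ E] (x : ι → E)
    {c : ι → ℂ} {R : ℝ} (hR : 0 < R) (hc : ∀ n, ‖c n‖ ≤ R) :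
    ∑ ε : ι → ℤˣ, ‖∑ n, ((rad ε n : ℂ) * c n) • x n‖ ≤
      2 * R * ∑ ε : ι → ℤˣ, ‖∑ n, (rad ε n : ℂ) • x n‖ := by
  have hre := contraction_real x (c := fun n => (c n).re / R) fun n => by
    rw [abs_div, abs_of_pos hR, div_le_one hR]
    exact (Complex.abs_re_le_norm _).trans (hc n)
  have him := contraction_real x (c := fun n => (c n).im / R) fun n => by
    rw [abs_div, abs_of_pos hR, div_le_one hR]
    exact (Complex.abs_im_le_norm _).trans (hc n)
  have hcoe : ∀ (r : ℝ) (y : E), r • y = (r : ℂ) • y := fun r y => (Complex.coe_smul r y).symm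
  simp only [hcoe] at hre him
  have key : ∀ ε : ι → ℤˣ, ‖∑ n, ((rad ε n : ℂ) * c n) • x n‖ ≤
      R * ‖∑ n, ((rad ε n * ((c n).re / R) : ℝ) : ℂ) • x n‖ +
      R * ‖∑ n, ((rad ε n * ((c n).im / R) : ℝ) : ℂ) • x n‖ := by
    intro ε
    have : ∑ n, ((rad ε n : ℂ) * c n) • x n =
        (R : ℂ) • ∑ n, ((rad ε n * ((c n).re / R) : ℝ) : ℂ) • x n +
        ((R : ℂ) * Complex.I) • ∑ n, ((rad ε n * ((c n).im / R) : ℝ) : ℂ) • x n := by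
      simp_rw [Finset.smul_sum, ← Finset.sum_add_distrib, smul_smul, ← add_smul]
      refine Finset.sum_congr rfl fun n _ => ?_
      congr 1
      have hR' : (R : ℂ) ≠ 0 := by exact_mod_cast hR.ne'
      conv_lhs => rw [← Complex.re_add_im (c n)]
      push_cast
      field_simp
    rw [this]
    refine (norm_add_le _ _).trans ?_
    rw [norm_smul, norm_smul, norm_mul, Complex.norm_I, mul_one, Complex.norm_real,
      Real.norm_of_nonneg hR.le]
  refine (Finset.sum_le_sum fun ε _ => key ε).trans ?_
  rw [Finset.sum_add_distrib, ← Finset.mul_sum, ← Finset.mul_sum]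
  nlinarith

end Signs

/-! ### Comparison of Rademacher processes and products of families -/

section Contraction

variable {ι α β : Type*} [DecidableEq ι]

/-- The sign vector which flips the coordinate `n`. -/
def flipSign (n : ι) : ι → ℤˣ := Function.update 1 n (-1)

lemma rad_flip_mul_self (n : ι) (ε : ι → ℤˣ) : rad (flipSign n * ε) n = -rad ε n := by
  simp [flipSign, rad]

lemma rad_flip_mul_of_ne {n k : ι} (h : k ≠ n) (ε : ι → ℤˣ) : rad (flipSign n * ε) k = rad ε k := by
  simp [flipSign, rad, h]

variable [Fintype ι]

lemma two_mul_sum_signs (n : ι) (f : (ι → ℤˣ) → ℝ) :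
    2 * ∑ ε, f ε = ∑ ε, (f ε + f (flipSign n * ε)) := by
  rw [Finset.sum_add_distrib, sum_mul_left_signs, two_mul]

/-- Replacing one coordinate by a contraction of it does not increase the expected supremum; the
supremum is expressed through choice functions `i : (ι → ℤˣ) → α`. -/
lemma contraction_one_coordinate (n : ι) (h : (ι → ℤˣ) → α → ℝ)
    (hh : ∀ ε i, h (flipSign n * ε) i = h ε i) (x y : α → ℝ) (hxy : ∀ i j, |y i - y j| ≤ |x i - x j|)
    {M : ℝ} (hM : ∀ i : (ι → ℤˣ) → α, ∑ ε, (h ε (i ε) + rad ε n * x (i ε)) ≤ M)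
    (i : (ι → ℤˣ) → α) : ∑ ε, (h ε (i ε) + rad ε n * y (i ε)) ≤ M := by
  classical
  -- On a pair {ε, flipped ε}, `h` does not see coordinate n, so the two choices may be exchanged.
  -- Exchanging them when needed makes the x-contribution equal to the absolute difference, which
  -- dominates the y-contribution.
  let i' : (ι → ℤˣ) → α := fun ε =>
    if 0 ≤ rad ε n * (x (i ε) - x (i (flipSign n * ε))) then i ε else i (flipSign n * ε)
  refine le_trans ?_ (hM i')
  have hflip : ∀ ε : ι → ℤˣ, flipSign n * (flipSign n * ε) = ε := fun ε => by
    rw [← mul_assoc, mul_self_signs, one_mul]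
  refine le_of_mul_le_mul_left ?_ (two_pos : (0 : ℝ) < 2)
  rw [two_mul_sum_signs n, two_mul_sum_signs n]
  refine Finset.sum_le_sum fun ε _ => ?_
  simp only [i', hflip, rad_flip_mul_self, hh]
  have h1 := abs_le.1 (hxy (i ε) (i (flipSign n * ε)))
  rcases rad_eq_one_or ε n with hr | hr <;> simp only [hr] <;>
    rcases le_total (x (i ε)) (x (i (flipSign n * ε))) with hx | hx <;>
    rcases eq_or_lt_of_le hx with hx' | hx' <;>
    [rw [hx'] at h1 ⊢; skip; rw [hx'] at h1 ⊢; skip; rw [hx'] at h1 ⊢; skip;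
      rw [hx'] at h1 ⊢; skip]
  all_goals
    split_ifs <;>
    first
      | (exfalso; linarith)
      | (simp only [sub_self, abs_zero, neg_zero] at h1; linarith)
      | (rw [abs_of_nonneg (by linarith)] at h1; linarith)
      | (rw [abs_of_nonpos (by linarith)] at h1; linarith)

/-- The contraction principle for Rademacher processes, signed version. -/
lemma contraction_signed (x y : α → ι → ℝ) (hxy : ∀ i j n, |y i n - y j n| ≤ |x i n - x j n|)
    {M : ℝ} (hM : ∀ i : (ι → ℤˣ) → α, ∑ ε, ∑ n, rad ε n * x (i ε) n ≤ M)
    (i : (ι → ℤˣ) → α) : ∑ ε, ∑ n, rad ε n * y (i ε) n ≤ M := by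
  -- Coordinates are replaced one at a time; S is the set already replaced.
  have key : ∀ S : Finset ι, ∀ i : (ι → ℤˣ) → α,
      ∑ ε, ∑ n, rad ε n * (if n ∈ S then y (i ε) n else x (i ε) n) ≤ M := by
    intro S
    induction S using Finset.induction_on with
    | empty => simpa using hM
    | insert k S hk ih =>
      intro i
      let h : (ι → ℤˣ) → α → ℝ := fun ε j =>
        ∑ n ∈ Finset.univ.erase k, rad ε n * (if n ∈ S then y j n else x j n)
      have hsplit : ∀ (ε : ι → ℤˣ) (f : ι → ℝ),
          ∑ n, rad ε n * f n = ∑ n ∈ Finset.univ.erase k, rad ε n * f n + rad ε k * f k :=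
        fun ε f => (Finset.sum_erase_add _ _ (Finset.mem_univ k)).symm
      have := contraction_one_coordinate k h (fun ε j => by
        refine Finset.sum_congr rfl fun n hn => ?_
        rw [rad_flip_mul_of_ne (Finset.ne_of_mem_erase hn)]) (fun j => x j k) (fun j => y j k)
        (fun i j => hxy i j k) (M := M) (fun i => by
          refine le_trans (le_of_eq ?_) (ih i)
          refine Finset.sum_congr rfl fun ε _ => ?_
          rw [hsplit]
          simp [h, hk]) i
      refine le_trans (le_of_eq ?_) this
      refine Finset.sum_congr rfl fun ε _ => ?_
      rw [hsplit]
      simp only [h, Finset.mem_insert_self, if_true]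
      congr 1
      refine Finset.sum_congr rfl fun n hn => ?_
      simp [Finset.mem_insert, Finset.ne_of_mem_erase hn]
  simpa using key Finset.univ i

/-- `RadBound x M` means that the expected supremum over `i` of `|∑ ε_n x_i(n)|`, multiplied by
the number of sign vectors, is at most `M`. -/
def RadBound {𝕜 : Type*} [RCLike 𝕜] (x : α → ι → 𝕜) (M : ℝ) : Prop :=
  ∀ i : (ι → ℤˣ) → α, ∑ ε : ι → ℤˣ, ‖∑ n, (rad ε n : 𝕜) * x (i ε) n‖ ≤ M

/-- The contraction principle for Rademacher processes. -/
lemma RadBound.contraction {x y : α → ι → ℝ} {M : ℝ} (hx : RadBound x M)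
    (hxy : ∀ i j n, |y i n - y j n| ≤ |x i n - x j n|) (h0 : ∀ i n, |y i n| ≤ |x i n|) :
    RadBound y (2 * M) := by
  intro i
  -- The extra index `none` carries the zero family, so choosing it truncates the signed sum at 0.
  -- Positive and negative parts are bounded separately, whence the factor 2; `h0` is the
  -- contraction hypothesis against the index `none`.
  let x' : Option α → ι → ℝ := fun o n => o.elim 0 fun j => x j n
  let y' : Option α → ι → ℝ := fun o n => o.elim 0 fun j => y j n
  have hM : ∀ o : (ι → ℤˣ) → Option α, ∑ ε, ∑ n, rad ε n * x' (o ε) n ≤ M := by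
    intro o
    refine le_trans (Finset.sum_le_sum fun ε _ => ?_) (hx fun ε => (o ε).getD (i ε))
    cases ho : o ε with
    | none => simp [x']
    | some j => simpa [x', ho] using le_abs_self _
  have hxy' : ∀ i j n, |y' i n - y' j n| ≤ |x' i n - x' j n| := by
    rintro (_ | i) (_ | j) n
    · simp [y']
    · simpa [x', y'] using h0 j n
    · simpa [x', y'] using h0 i n
    · simpa [x', y'] using hxy i j n
  let S : (ι → ℤˣ) → ℝ := fun ε => ∑ n, rad ε n * y (i ε) n
  have hpos : ∑ ε, max (S ε) 0 ≤ M := by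
    have := contraction_signed x' y' hxy' hM fun ε => if 0 ≤ S ε then some (i ε) else none
    refine le_trans (le_of_eq (Finset.sum_congr rfl fun ε _ => ?_)) this
    split_ifs with h
    · simpa [y', S] using h
    · simpa [y'] using (not_le.1 h).le
  have hneg : ∑ ε, max (-S ε) 0 ≤ M := by
    have := contraction_signed x' (fun o n => -y' o n)
      (fun i j n => by
        have := hxy' i j n
        rwa [← abs_neg, neg_sub, sub_neg_eq_add, neg_add_eq_sub]) hM
      fun ε => if S ε ≤ 0 then some (i ε) else none
    refine le_trans (le_of_eq (Finset.sum_congr rfl fun ε _ => ?_)) this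
    split_ifs with h
    · rw [max_eq_left (by linarith)]
      simp [y', S]
    · simpa [y'] using (not_le.1 h).le
  have habs : ∀ r : ℝ, ‖r‖ = max r 0 + max (-r) 0 := fun r => by
    rw [Real.norm_eq_abs]
    rcases le_total 0 r with h | h
    · rw [abs_of_nonneg h, max_eq_left h, max_eq_right (by linarith)]; ring
    · rw [abs_of_nonpos h, max_eq_right h, max_eq_left (by linarith)]; ring
  calc ∑ ε : ι → ℤˣ, ‖∑ n, rad ε n * y (i ε) n‖ = ∑ ε, (max (S ε) 0 + max (-S ε) 0) :=
        Finset.sum_congr rfl fun ε _ => habs _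
    _ ≤ 2 * M := by rw [Finset.sum_add_distrib]; linarith

lemma RadBound.add {𝕜 : Type*} [RCLike 𝕜] {x : α → ι → 𝕜} {y : β → ι → 𝕜} {M M' : ℝ}
    (hx : RadBound x M) (hy : RadBound y M') :
    RadBound (fun (p : α × β) n => x p.1 n + y p.2 n) (M + M') := by
  intro i
  refine le_trans ?_ (add_le_add (hx fun ε => (i ε).1) (hy fun ε => (i ε).2))
  rw [← Finset.sum_add_distrib]
  refine Finset.sum_le_sum fun ε _ => le_trans (le_of_eq ?_) (norm_add_le _ _)
  rw [← Finset.sum_add_distrib]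
  simp_rw [mul_add]

lemma RadBound.comp {𝕜 : Type*} [RCLike 𝕜] {x : α → ι → 𝕜} {M : ℝ} (hx : RadBound x M)
    (f : β → α) : RadBound (fun j => x (f j)) M := fun i => hx fun ε => f (i ε)

lemma RadBound.const_mul {𝕜 : Type*} [RCLike 𝕜] {x : α → ι → 𝕜} {M : ℝ} (hx : RadBound x M)
    (c : 𝕜) : RadBound (fun j n => c * x j n) (‖c‖ * M) := by
  intro i
  refine le_trans (le_of_eq ?_) (mul_le_mul_of_nonneg_left (hx i) (norm_nonneg c))
  rw [Finset.mul_sum]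
  refine Finset.sum_congr rfl fun ε _ => ?_
  rw [← norm_mul, Finset.mul_sum]
  congr 1
  exact Finset.sum_congr rfl fun n _ => by ring

/-- Products of two real families, with weights `r`. -/
lemma RadBound.mul_real {r : ι → ℝ} {x : α → ι → ℝ} {y : β → ι → ℝ} {B M M' : ℝ} (hB : 0 ≤ B)
    (hxB : ∀ i n, |x i n| ≤ B) (hyB : ∀ i n, |y i n| ≤ B)
    (hx : RadBound (fun i n => r n * x i n) M) (hy : RadBound (fun i n => r n * y i n) M') :
    RadBound (fun (p : α × β) n => r n * (x p.1 n * y p.2 n)) (4 * B * (M + M')) := by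
  -- Squaring is 4B-Lipschitz on [-2B, 2B]; the product is recovered from the squares of x + y and x
  -- - y by polarization.
  have hsq : ∀ {u v : ℝ}, |u| ≤ 2 * B → |v| ≤ 2 * B → ∀ ρ : ℝ,
      |ρ * u ^ 2 - ρ * v ^ 2| ≤ |4 * B * (ρ * u) - 4 * B * (ρ * v)| := by
    intro u v hu hv ρ
    have h1 : ρ * u ^ 2 - ρ * v ^ 2 = ρ * (u - v) * (u + v) := by ring
    have h2 : 4 * B * (ρ * u) - 4 * B * (ρ * v) = ρ * (u - v) * (4 * B) := by ring
    rw [h1, h2, abs_mul _ (u + v), abs_mul _ (4 * B), abs_of_nonneg (by linarith : 0 ≤ 4 * B)]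
    exact mul_le_mul_of_nonneg_left ((abs_add_le u v).trans (by linarith)) (abs_nonneg _)
  have hpow : ∀ z : β → ι → ℝ, (∀ j n, |z j n| ≤ B) → RadBound (fun j n => r n * z j n) M' →
      RadBound (fun (p : α × β) n => r n * (x p.1 n + z p.2 n) ^ 2) (2 * (4 * B * (M + M'))) := by
    intro z hzB hz
    have h1 := (hx.add hz).const_mul (4 * B)
    rw [Real.norm_of_nonneg (by linarith)] at h1
    have hb : ∀ (p : α × β) n, |x p.1 n + z p.2 n| ≤ 2 * B := fun p n =>
      (abs_add_le _ _).trans (by linarith [hxB p.1 n, hzB p.2 n])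
    refine h1.contraction (fun p q n => ?_) fun p n => ?_
    · simpa [mul_add] using hsq (hb p n) (hb q n) (r n)
    · have := hsq (hb p n) (v := 0) (by simpa using hB) (r n)
      simpa [mul_add] using this
  have hp := hpow y hyB hy
  have hn := hpow (fun j n => -y j n) (by simpa using hyB) (by
    have := hy.const_mul (-1)
    simpa using this)
  have hn' := hn.const_mul (-1)
  have h := ((hp.add hn').const_mul (1 / 4)).comp (fun p : α × β => (p, p))
  norm_num at h
  intro i
  refine le_trans (le_of_eq (Finset.sum_congr rfl fun ε _ => ?_)) ((h i).trans (by linarith))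
  congr 1
  refine Finset.sum_congr rfl fun n _ => ?_
  ring

lemma RadBound.re {r : ι → ℝ} {x : α → ι → ℂ} {M : ℝ}
    (hx : RadBound (fun i n => (r n : ℂ) * x i n) M) :
    RadBound (fun i n => r n * (x i n).re) M := by
  intro i
  refine le_trans (Finset.sum_le_sum fun ε _ => ?_) (hx i)
  refine le_trans (le_of_eq ?_) (Complex.abs_re_le_norm _)
  simp [Complex.re_sum]

lemma RadBound.im {r : ι → ℝ} {x : α → ι → ℂ} {M : ℝ}
    (hx : RadBound (fun i n => (r n : ℂ) * x i n) M) :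
    RadBound (fun i n => r n * (x i n).im) M := by
  intro i
  refine le_trans (Finset.sum_le_sum fun ε _ => ?_) (hx i)
  refine le_trans (le_of_eq ?_) (Complex.abs_im_le_norm _)
  simp [Complex.im_sum]

/-- Products of two complex families, with weights `r`. -/
lemma RadBound.mul_complex {r : ι → ℝ} {x : α → ι → ℂ} {y : β → ι → ℂ} {B M M' : ℝ} (hB : 0 ≤ B)
    (hxB : ∀ i n, ‖x i n‖ ≤ B) (hyB : ∀ i n, ‖y i n‖ ≤ B)
    (hx : RadBound (fun i n => (r n : ℂ) * x i n) M)
    (hy : RadBound (fun i n => (r n : ℂ) * y i n) M') :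
    RadBound (fun (p : α × β) n => (r n : ℂ) * (x p.1 n * y p.2 n)) (16 * B * (M + M')) := by
  have hxr := fun i n => (Complex.abs_re_le_norm (x i n)).trans (hxB i n)
  have hxi := fun i n => (Complex.abs_im_le_norm (x i n)).trans (hxB i n)
  have hyr := fun i n => (Complex.abs_re_le_norm (y i n)).trans (hyB i n)
  have hyi := fun i n => (Complex.abs_im_le_norm (y i n)).trans (hyB i n)
  have hrr := RadBound.mul_real hB hxr hyr hx.re hy.re
  have hii := RadBound.mul_real hB hxi hyi hx.im hy.im
  have hri := RadBound.mul_real hB hxr hyi hx.re hy.im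
  have hir := RadBound.mul_real hB hxi hyr hx.im hy.re
  intro i
  have hsum := add_le_add (add_le_add (hrr i) (hii i)) (add_le_add (hri i) (hir i))
  simp_rw [← Finset.sum_add_distrib] at hsum
  refine le_trans (Finset.sum_le_sum fun ε _ => ?_) (hsum.trans_eq (by ring))
  refine (Complex.norm_le_abs_re_add_abs_im _).trans (add_le_add ?_ ?_)
  · refine le_trans (le_of_eq ?_) (norm_sub_le _ _)
    rw [← Finset.sum_sub_distrib, Complex.re_sum, Real.norm_eq_abs]
    congr 1
    refine Finset.sum_congr rfl fun n _ => ?_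
    simp
    ring
  · refine le_trans (le_of_eq ?_) (norm_add_le _ _)
    rw [← Finset.sum_add_distrib, Complex.im_sum, Real.norm_eq_abs]
    congr 1
    refine Finset.sum_congr rfl fun n _ => ?_
    simp
    ring

/-- The constant in the comparison of `(k+1)`-fold products with single factors. -/
noncomputable def tensorConst (B : ℝ) : ℕ → ℝ
  | 0 => 1
  | k + 1 => 16 * B ^ (k + 1) * (1 + tensorConst B k)

lemma tensorConst_pos {B : ℝ} (hB : 1 ≤ B) (k : ℕ) : 0 < tensorConst B k := by
  induction k with
  | zero => simp [tensorConst]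
  | succ k ih => rw [tensorConst]; positivity

/-- One factor is split off at a time. Since B ≥ 1, the power B^(k+1) bounds both the single factor
and the remaining product, as `RadBound.mul_complex` requires. -/
lemma RadBound.prod {r : ι → ℝ} {x : α → ι → ℂ} {B M : ℝ} (hB : 1 ≤ B)
    (hxB : ∀ i n, ‖x i n‖ ≤ B) (hx : RadBound (fun i n => (r n : ℂ) * x i n) M) (k : ℕ) :
    RadBound (fun (t : Fin (k + 1) → α) n => (r n : ℂ) * ∏ j, x (t j) n)
      (tensorConst B k * M) := by
  induction k with
  | zero =>
    intro i
    simpa [tensorConst] using hx fun ε => i ε 0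
  | succ k ih =>
    have hB0 : 0 ≤ B := by linarith
    have hprod : ∀ (t : Fin (k + 1) → α) n, ‖∏ j, x (t j) n‖ ≤ B ^ (k + 1) := by
      intro t n
      rw [norm_prod]
      refine (Finset.prod_le_prod (fun _ _ => norm_nonneg _) fun j _ => hxB (t j) n).trans ?_
      simp
    have h := RadBound.mul_complex (pow_nonneg hB0 (k + 1))
      (fun i n => (hxB i n).trans (le_self_pow₀ hB (Nat.succ_ne_zero k))) hprod hx ih
    have h' := h.comp fun t : Fin (k + 2) → α => (t 0, fun j : Fin (k + 1) => t j.succ)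
    intro i
    refine le_trans (le_of_eq (Finset.sum_congr rfl fun ε _ => ?_)) ((h' i).trans_eq ?_)
    · simp_rw [Fin.prod_univ_succ]
    · simp only [tensorConst]; ring

end Contraction

/-- `(x n)` is randomly Sidon in the normed space `E` with respect to independent random signs. -/
def RademacherSidon {E : Type*} [NormedAddCommGroup E] [NormedSpace ℂ E] (x : ℕ → E) : Prop :=
  ∃ C : ℝ, 0 < C ∧ ∀ (s : Finset ℕ) (a : s → ℂ),
    Fintype.card (s → ℤˣ) * ∑ n, ‖a n‖ ≤
      C * ∑ ε : s → ℤˣ, ‖∑ n : s, ((rad ε n : ℂ) * a n) • x n‖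

/-! ### Essential bounds and finite sums in L∞ -/

section Linfty

variable {T : Type*} [MeasurableSpace T] {m : Measure T} {ψ : ℕ → T → ℂ}

lemma BoundedInLinfty.memLp (hψ : BoundedInLinfty m ψ) (n : ℕ) : MemLp (ψ n) ∞ m := by
  obtain ⟨h1, C, hC⟩ := hψ
  exact ⟨h1 n, (hC n).trans_lt ENNReal.coe_lt_top⟩

lemma BoundedInLinfty.exists_bound (hψ : BoundedInLinfty m ψ) :
    ∃ B : ℝ, 1 ≤ B ∧ ∀ᵐ t ∂m, ∀ n, ‖ψ n t‖ ≤ B := by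
  obtain ⟨h1, C, hC⟩ := hψ
  -- Adding 1 ensures a bound at least 1, so that its powers increase.
  refine ⟨C + 1, by simp, ae_all_iff.2 fun n => ?_⟩
  filter_upwards [ae_le_eLpNormEssSup (f := ψ n) (μ := m)] with t ht
  rw [← eLpNorm_exponent_top] at ht
  have h2 : ‖ψ n t‖ₑ ≤ (C : ℝ≥0∞) := ht.trans (hC n)
  rw [enorm_le_coe] at h2
  have : ‖ψ n t‖ ≤ C := by exact_mod_cast h2
  linarith

lemma coeFn_sum_smul_toLp {ι : Type*} (s : Finset ι) {ψ : ι → T → ℂ} (hψ : ∀ n, MemLp (ψ n) ∞ m)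
    (b : ι → ℂ) :
    ((∑ n ∈ s, b n • (hψ n).toLp (ψ n) : Lp ℂ ∞ m) : T → ℂ) =ᵐ[m]
      fun t => ∑ n ∈ s, b n * ψ n t := by
  refine (Lp.coeFn_finsetSum _ _).trans ?_
  have : ∀ᵐ t ∂m, ∀ n ∈ s, ((b n • (hψ n).toLp (ψ n) : Lp ℂ ∞ m) : T → ℂ) t = b n * ψ n t := by
    refine (Finset.eventually_all s).2 fun n _ => ?_
    filter_upwards [Lp.coeFn_smul (b n) ((hψ n).toLp (ψ n)), (hψ n).coeFn_toLp] with t h1 h2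
    rw [h1, Pi.smul_apply, h2, smul_eq_mul]
  filter_upwards [this] with t ht
  rw [Finset.sum_apply]
  exact Finset.sum_congr rfl ht

lemma enorm_sum_smul_toLp {ι : Type*} (s : Finset ι) {ψ : ι → T → ℂ} (hψ : ∀ n, MemLp (ψ n) ∞ m)
    (b : ι → ℂ) :
    ‖(∑ n ∈ s, b n • (hψ n).toLp (ψ n) : Lp ℂ ∞ m)‖ₑ =
      eLpNorm (fun t => ∑ n ∈ s, b n * ψ n t) ∞ m := by
  rw [Lp.enorm_def]
  exact eLpNorm_congr_ae (coeFn_sum_smul_toLp s hψ b)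

lemma ae_norm_sum_le {ι : Type*} (s : Finset ι) {ψ : ι → T → ℂ} (hψ : ∀ n, MemLp (ψ n) ∞ m)
    (b : ι → ℂ) :
    ∀ᵐ t ∂m, ‖∑ n ∈ s, b n * ψ n t‖ ≤ ‖(∑ n ∈ s, b n • (hψ n).toLp (ψ n) : Lp ℂ ∞ m)‖ := by
  filter_upwards [ae_le_eLpNormEssSup (f := fun t => ∑ n ∈ s, b n * ψ n t) (μ := m)] with t ht
  rw [← eLpNorm_exponent_top, ← enorm_sum_smul_toLp s hψ b] at ht
  exact enorm_le_iff_norm_le.1 ht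

end Linfty

/-! ### From tensor Sidon to random signs -/

lemma exists_norm_mul_unit (a : ℂ) : ∃ u : ℂ, ‖u‖ = 1 ∧ a = ‖a‖ * u :=
  ⟨Complex.exp (a.arg * Complex.I), by rw [Complex.norm_exp_ofReal_mul_I],
    (Complex.norm_mul_exp_arg_mul_I a).symm⟩

/-- Tensor Sidon systems are randomly Sidon with respect to random signs. -/
theorem TensorSidon.rademacherSidon {T : Type*} [MeasurableSpace T] {m : Measure T}
    [IsProbabilityMeasure m] {ψ : ℕ → T → ℂ} (hψ : BoundedInLinfty m ψ) {k : ℕ}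
    (h : TensorSidon m (k + 1) ψ) : RademacherSidon fun n => (hψ.memLp n).toLp (ψ n) := by
  obtain ⟨α, hα⟩ := h
  obtain ⟨B, hB, hψB⟩ := hψ.exists_bound
  have hK := tensorConst_pos hB k
  set K := tensorConst B k
  set Ψ : ℕ → Lp ℂ ∞ m := fun n => (hψ.memLp n).toLp (ψ n) with hΨ
  refine ⟨2 * (α + 1) * K, by positivity, fun s a => ?_⟩
  choose u hu hau using fun n => exists_norm_mul_unit (a n)
  set S : ℝ := ∑ n, ‖a n‖ with hS
  have hS0 : 0 ≤ S := Finset.sum_nonneg fun _ _ => norm_nonneg _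
  rcases hS0.eq_or_lt with h0 | hSpos
  · rw [← h0, mul_zero]
    exact mul_nonneg (by positivity) (Finset.sum_nonneg fun _ _ => norm_nonneg _)
  -- A set of full measure on which the essential bounds hold pointwise for all the finitely many
  -- signs; it serves as the index set of the process.
  let T₀ : Set T := {t | (∀ n, ‖ψ n t‖ ≤ B) ∧ ∀ ε : s → ℤˣ,
    ‖∑ n : s, ((rad ε n : ℂ) * a n) * ψ n t‖ ≤ ‖∑ n : s, ((rad ε n : ℂ) * a n) • Ψ n‖}
  have hT₀ : ∀ᵐ t ∂m, t ∈ T₀ := by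
    filter_upwards [hψB, (Filter.eventually_all (l := ae m)).2 fun ε : s → ℤˣ =>
      ae_norm_sum_le Finset.univ (fun n : s => hψ.memLp n) fun n => (rad ε n : ℂ) * a n]
      with t h1 h2 using ⟨h1, h2⟩
  have hpi : ∀ᵐ t ∂(Measure.pi fun _ : Fin (k + 1) => m), ∀ j, t j ∈ T₀ :=
    Filter.eventually_all.2 fun j => Measure.tendsto_eval_ae_ae.eventually hT₀
  -- The weights must be real for `RadBound.prod`, so the phase of a_n is attached to every factor;
  -- its power is still unimodular and does not change the l1 norm.
  let F : (s → ℤˣ) → (Fin (k + 1) → T) → ℂ := fun ε t =>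
    ∑ n, (rad ε n : ℂ) * ((‖a n‖ : ℂ) * ∏ j, (u n * ψ n (t j)))
  -- The Sidon inequality is almost attained at an actual point of T₀^(k+1). The constant 2(α + 1)
  -- exceeds α strictly, so failure almost everywhere would contradict S > 0.
  have hex : ∀ ε : s → ℤˣ, ∃ t : Fin (k + 1) → T₀, S ≤ 2 * (α + 1) * ‖F ε fun j => t j‖ := by
    intro ε
    by_contra! hcon
    have hbound : ∀ᵐ t ∂(Measure.pi fun _ : Fin (k + 1) => m), ‖F ε t‖ ≤ S / (2 * (α + 1)) := by
      filter_upwards [hpi] with t ht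
      rw [le_div_iff₀' (by positivity)]
      exact (hcon fun j => ⟨t j, ht j⟩).le
    let b : ℕ → ℂ := fun n => if hn : n ∈ s then
      (rad ε ⟨n, hn⟩ : ℂ) * ((‖a ⟨n, hn⟩‖ : ℂ) * u ⟨n, hn⟩ ^ (k + 1)) else 0
    have h1 := hα s b
    have h2 : eLpNorm (fun t => ∑ n ∈ s, b n * tensorPower (k + 1) (ψ n) t) ∞
        (Measure.pi fun _ : Fin (k + 1) => m) ≤ ENNReal.ofReal (S / (2 * (α + 1))) := by
      rw [eLpNorm_exponent_top]
      refine eLpNormEssSup_le_of_ae_bound ?_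
      filter_upwards [hbound] with t ht
      refine le_trans (le_of_eq ?_) ht
      congr 1
      rw [← Finset.sum_coe_sort]
      refine Finset.sum_congr rfl fun n _ => ?_
      simp only [b, n.2, dif_pos, tensorPower, Finset.prod_mul_distrib, Finset.prod_const,
        Finset.card_univ, Fintype.card_fin]
      ring
    have h3 : ∑ n ∈ s, ‖b n‖ₑ = ENNReal.ofReal S := by
      rw [← Finset.sum_coe_sort, hS, ENNReal.ofReal_sum_of_nonneg fun _ _ => norm_nonneg _]
      refine Finset.sum_congr rfl fun n _ => ?_
      rw [← ofReal_norm (b n)]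
      simp [b, hu]
    rw [h3] at h1
    have h4 := h1.trans (mul_le_mul_right h2 _)
    rw [← ENNReal.ofReal_coe_nnreal, ← ENNReal.ofReal_mul (by positivity),
      ENNReal.ofReal_le_ofReal_iff (by positivity), mul_div_assoc', le_div_iff₀ (by positivity)]
      at h4
    nlinarith [α.2]
  choose t ht using hex
  have hrad : RadBound (fun (t : T₀) (n : s) => ((‖a n‖ : ℝ) : ℂ) * (u n * ψ n t))
      (∑ ε : s → ℤˣ, ‖∑ n : s, ((rad ε n : ℂ) * a n) • Ψ n‖) := by
    intro i
    refine Finset.sum_le_sum fun ε _ => le_trans (le_of_eq ?_) ((i ε).2.2 ε)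
    congr 1
    refine Finset.sum_congr rfl fun n _ => ?_
    conv_rhs => rw [hau n]
    simp only [Complex.coe_algebraMap, RCLike.ofReal]
    ring
  have hprod := hrad.prod hB (fun t n => by rw [norm_mul, hu, one_mul]; exact t.2.1 n) k t
  calc (Fintype.card (s → ℤˣ) : ℝ) * S = ∑ ε : s → ℤˣ, S := by simp
    _ ≤ ∑ ε : s → ℤˣ, 2 * (α + 1) * ‖F ε fun j => t ε j‖ := Finset.sum_le_sum fun ε _ => ht ε
    _ ≤ _ := by
      rw [← Finset.mul_sum, mul_assoc _ K]
      exact mul_le_mul_of_nonneg_left hprod (by positivity)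

/-! ### Gaussian averages against sign averages -/

section Gaussian

lemma measurable_gaussianPair :
    Measurable fun p : ℝ × ℝ =>
      (((Real.sqrt 2)⁻¹ : ℝ) : ℂ) * ((p.1 : ℂ) + (p.2 : ℂ) * Complex.I) := by
  fun_prop

instance : IsProbabilityMeasure stdComplexGaussian :=
  Measure.isProbabilityMeasure_map measurable_gaussianPair.aemeasurable

lemma measurePreserving_neg_stdComplexGaussian :
    MeasurePreserving (fun z : ℂ => -z) stdComplexGaussian stdComplexGaussian := by
  refine ⟨measurable_neg, ?_⟩
  have h1 : MeasurePreserving (fun x : ℝ => -x) (gaussianReal 0 1) (gaussianReal 0 1) :=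
    ⟨measurable_neg, by rw [gaussianReal_map_neg, neg_zero]⟩
  have h2 := h1.prod h1
  rw [stdComplexGaussian, Measure.map_map measurable_neg measurable_gaussianPair]
  conv_rhs => rw [← h2.map_eq, Measure.map_map measurable_gaussianPair h2.measurable]
  congr 1
  funext p
  simp only [Function.comp_apply, Prod.map_fst, Prod.map_snd]
  push_cast
  ring

lemma memLp_stdComplexGaussian : MemLp (fun z : ℂ => z) 2 stdComplexGaussian := by
  rw [stdComplexGaussian, memLp_map_measure_iff (g := fun z : ℂ => z) aestronglyMeasurable_id
    measurable_gaussianPair.aemeasurable]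
  have h : MemLp (fun x : ℝ => (x : ℂ)) 2 (gaussianReal 0 1) :=
    (memLp_id_gaussianReal 2).ofReal
  have h1 := h.comp_measurePreserving
    (measurePreserving_fst (μ := gaussianReal 0 1) (ν := gaussianReal 0 1))
  have h2 := h.comp_measurePreserving
    (measurePreserving_snd (μ := gaussianReal 0 1) (ν := gaussianReal 0 1))
  exact (h1.add (h2.mul_const Complex.I)).const_mul _

lemma lintegral_enorm_sq_stdComplexGaussian_lt_top :
    ∫⁻ z, ‖z‖ₑ ^ 2 ∂stdComplexGaussian < ∞ := by
  have := (memLp_stdComplexGaussian.integrable_norm_pow two_ne_zero).hasFiniteIntegral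
  simpa [HasFiniteIntegral, enorm_pow] using this

lemma lintegral_enorm_stdComplexGaussian_lt_top : ∫⁻ z, ‖z‖ₑ ∂stdComplexGaussian < ∞ := by
  have := (memLp_stdComplexGaussian.integrable (by norm_num)).hasFiniteIntegral
  simpa [HasFiniteIntegral] using this

lemma lintegral_enorm_stdComplexGaussian_ne_zero : ∫⁻ z, ‖z‖ₑ ∂stdComplexGaussian ≠ 0 := by
  rw [stdComplexGaussian, lintegral_map measurable_enorm measurable_gaussianPair]
  intro h
  rw [lintegral_eq_zero_iff (by fun_prop)] at h
  have h1 : ∀ᵐ p ∂(gaussianReal 0 1).prod (gaussianReal 0 1), p.1 = 0 := by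
    filter_upwards [h] with p hp
    simp only [Pi.zero_apply, enorm_eq_zero, mul_eq_zero, Complex.ext_iff] at hp
    norm_num at hp
    exact hp.1
  have h2 := measurePreserving_fst (μ := gaussianReal 0 1) (ν := gaussianReal 0 1)
  have : NullSingletonClass (gaussianReal 0 1) := nullSingletonClass_gaussianReal one_ne_zero
  have h3 := h2.measure_preimage (measurableSet_singleton (0 : ℝ)).compl.nullMeasurableSet
  rw [(prob_compl_eq_one_iff (measurableSet_singleton (0 : ℝ))).2 (measure_singleton 0)] at h3
  exact zero_ne_one ((ae_iff.1 h1).symm.trans h3)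

variable {ι : Type*} [Fintype ι] {E : Type*} [NormedAddCommGroup E] [NormedSpace ℂ E]

lemma measurePreserving_signs (ε : ι → ℤˣ) :
    MeasurePreserving (fun (z : ι → ℂ) n => (rad ε n : ℂ) * z n)
      (Measure.pi fun _ => stdComplexGaussian) (Measure.pi fun _ => stdComplexGaussian) := by
  refine measurePreserving_pi (f := fun n z => (rad ε n : ℂ) * z) _ _ fun n => ?_
  rcases rad_eq_one_or ε n with h | h
  · simpa [h] using! MeasurePreserving.id stdComplexGaussian
  · simpa [h] using measurePreserving_neg_stdComplexGaussian

lemma measurable_enorm_sum_smul (x : ι → E) : Measurable fun z : ι → ℂ => ‖∑ n, z n • x n‖ₑ :=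
  (by fun_prop : Continuous fun z : ι → ℂ => ‖∑ n, z n • x n‖ₑ).measurable

lemma lintegral_eval_gaussian {f : ℂ → ℝ≥0∞} (hf : Measurable f) (n : ι) :
    ∫⁻ z, f (z n) ∂(Measure.pi fun _ : ι => stdComplexGaussian) =
      ∫⁻ z, f z ∂stdComplexGaussian :=
  (measurePreserving_eval (fun _ : ι => stdComplexGaussian) n).lintegral_comp hf

variable [DecidableEq ι]

/-- The Gaussian product law is invariant under every sign change, so each of the summands has the
same integral. -/
lemma card_mul_lintegral_gaussian (x : ι → E) :
    (Fintype.card (ι → ℤˣ) : ℝ≥0∞) *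
        ∫⁻ z, ‖∑ n, z n • x n‖ₑ ∂(Measure.pi fun _ : ι => stdComplexGaussian) =
      ∫⁻ z, ∑ ε : ι → ℤˣ, ‖∑ n, ((rad ε n : ℂ) * z n) • x n‖ₑ
        ∂(Measure.pi fun _ : ι => stdComplexGaussian) := by
  rw [lintegral_finsetSum]
  · have h : ∀ ε : ι → ℤˣ, ∫⁻ z, ‖∑ n, ((rad ε n : ℂ) * z n) • x n‖ₑ
        ∂(Measure.pi fun _ : ι => stdComplexGaussian) =
        ∫⁻ z, ‖∑ n, z n • x n‖ₑ ∂(Measure.pi fun _ : ι => stdComplexGaussian) := fun ε =>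
      (measurePreserving_signs ε).lintegral_comp (measurable_enorm_sum_smul x)
    simp [h]
  · intro ε _
    exact (measurable_enorm_sum_smul x).comp (measurePreserving_signs ε).measurable

/-- Gaussian averages are controlled by Rademacher averages up to a small multiple of
`∑ ‖x n‖`. -/
lemma card_mul_lintegral_gaussian_le (x : ι → E) {R : ℝ} (hR : 0 < R) :
    (Fintype.card (ι → ℤˣ) : ℝ≥0∞) *
        ∫⁻ z, ‖∑ n, z n • x n‖ₑ ∂(Measure.pi fun _ : ι => stdComplexGaussian) ≤
      ENNReal.ofReal (2 * R) * ∑ ε : ι → ℤˣ, ‖∑ n, (rad ε n : ℂ) • x n‖ₑ +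
      Fintype.card (ι → ℤˣ) * (ENNReal.ofReal R⁻¹ * (∫⁻ z, ‖z‖ₑ ^ 2 ∂stdComplexGaussian) *
        ∑ n, ‖x n‖ₑ) := by
  have key : ∀ z : ι → ℂ, ∑ ε : ι → ℤˣ, ‖∑ n, ((rad ε n : ℂ) * z n) • x n‖ ≤
      2 * R * ∑ ε : ι → ℤˣ, ‖∑ n, (rad ε n : ℂ) • x n‖ +
      Fintype.card (ι → ℤˣ) * ∑ n, R⁻¹ * ‖z n‖ ^ 2 * ‖x n‖ := by
    intro z
    classical
    -- The truncated part falls under the contraction principle; on the tail ‖z‖ > R one has ‖z‖ ≤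
    -- ‖z‖²/R, which is small after integration.
    let c : ι → ℂ := fun n => if ‖z n‖ ≤ R then z n else 0
    have hc : ∀ n, ‖c n‖ ≤ R := fun n => by
      simp only [c]; split_ifs with h
      · exact h
      · simpa using hR.le
    have hd : ∀ n, ‖z n - c n‖ ≤ R⁻¹ * ‖z n‖ ^ 2 := fun n => by
      simp only [c]; split_ifs with h
      · simp only [sub_self, norm_zero]; positivity
      · rw [sub_zero, le_inv_mul_iff₀ hR]
        nlinarith [norm_nonneg (z n), not_le.1 h]
    have hsplit : ∀ ε : ι → ℤˣ, ‖∑ n, ((rad ε n : ℂ) * z n) • x n‖ ≤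
        ‖∑ n, ((rad ε n : ℂ) * c n) • x n‖ + ∑ n, R⁻¹ * ‖z n‖ ^ 2 * ‖x n‖ := by
      intro ε
      have : ∑ n, ((rad ε n : ℂ) * z n) • x n = ∑ n, ((rad ε n : ℂ) * c n) • x n +
          ∑ n, ((rad ε n : ℂ) * (z n - c n)) • x n := by
        rw [← Finset.sum_add_distrib]
        refine Finset.sum_congr rfl fun n _ => ?_
        rw [← add_smul]; congr 1; ring
      rw [this]
      refine (norm_add_le _ _).trans (add_le_add_right ?_ _)
      refine (norm_sum_le _ _).trans (Finset.sum_le_sum fun n _ => ?_)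
      rw [norm_smul, norm_mul, Complex.norm_real, Real.norm_eq_abs, abs_rad, one_mul]
      exact mul_le_mul_of_nonneg_right (hd n) (norm_nonneg _)
    refine (Finset.sum_le_sum fun ε _ => hsplit ε).trans ?_
    rw [Finset.sum_add_distrib, Finset.sum_const, Finset.card_univ, nsmul_eq_mul]
    exact add_le_add_left (contraction_complex x hR hc) _
  have key' : ∀ z : ι → ℂ, ∑ ε : ι → ℤˣ, ‖∑ n, ((rad ε n : ℂ) * z n) • x n‖ₑ ≤
      ENNReal.ofReal (2 * R) * ∑ ε : ι → ℤˣ, ‖∑ n, (rad ε n : ℂ) • x n‖ₑ +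
      Fintype.card (ι → ℤˣ) * ∑ n, ENNReal.ofReal R⁻¹ * ‖z n‖ₑ ^ 2 * ‖x n‖ₑ := by
    intro z
    have h := ENNReal.ofReal_le_ofReal (key z)
    rw [ENNReal.ofReal_add (by positivity) (by positivity),
      ENNReal.ofReal_mul (p := 2 * R) (by positivity),
      ENNReal.ofReal_mul (p := (Fintype.card (ι → ℤˣ) : ℝ)) (by positivity),
      ENNReal.ofReal_natCast,
      ENNReal.ofReal_sum_of_nonneg fun _ _ => norm_nonneg _,
      ENNReal.ofReal_sum_of_nonneg fun _ _ => norm_nonneg _,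
      ENNReal.ofReal_sum_of_nonneg fun _ _ => by positivity] at h
    simpa only [ofReal_norm, ENNReal.ofReal_mul (inv_nonneg.2 hR.le), ENNReal.ofReal_pow
      (norm_nonneg _), ENNReal.ofReal_mul (mul_nonneg (inv_nonneg.2 hR.le) (sq_nonneg (norm _)))] using h
  rw [card_mul_lintegral_gaussian]
  refine (lintegral_mono key').trans ?_
  have hm : ∀ n, Measurable fun z : ι → ℂ => ENNReal.ofReal R⁻¹ * ‖z n‖ₑ ^ 2 * ‖x n‖ₑ :=
    fun n => by fun_prop
  rw [lintegral_add_left measurable_const, lintegral_const, measure_univ, mul_one,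
    lintegral_const_mul _ (Finset.measurable_sum _ fun n _ => hm n),
    lintegral_finsetSum _ fun n _ => hm n, Finset.mul_sum (s := Finset.univ) (f := fun n => ‖x n‖ₑ)]
  refine add_le_add_right (mul_le_mul_right (Finset.sum_le_sum fun n _ => le_of_eq ?_) _) _
  rw [lintegral_mul_const _ (by fun_prop), lintegral_const_mul _ (by fun_prop),
    lintegral_eval_gaussian (f := fun z => ‖z‖ₑ ^ 2) (by fun_prop) n]

end Gaussian

/-! ### Equivalence of Gaussian and Rademacher randomness -/

section RandomlySidon

variable {Ω : Type*} [MeasurableSpace Ω] {P : Measure Ω} [IsProbabilityMeasure P]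
  {g : ℕ → Ω → ℂ} {T : Type*} [MeasurableSpace T] {m : Measure T} {ψ : ℕ → T → ℂ}

lemma IsComplexGaussianSequence.map_restrict (hg : IsComplexGaussianSequence P g) (s : Finset ℕ) :
    P.map (fun ω (n : s) => g n ω) = Measure.pi fun _ : s => stdComplexGaussian := by
  have h := hg.indep.precomp (g := ((↑) : s → ℕ)) Subtype.val_injective
  rw [iIndepFun_iff_map_fun_eq_pi_map fun n : s => (hg.hasLaw n).aemeasurable] at h
  rw [h]
  congr 1
  funext n
  exact (hg.hasLaw n).map_eq

lemma IsComplexGaussianSequence.lintegral_eLpNorm (hg : IsComplexGaussianSequence P g)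
    (hψ : ∀ n, MemLp (ψ n) ∞ m) (s : Finset ℕ) (a : ℕ → ℂ) :
    ∫⁻ ω, eLpNorm (fun t => ∑ n ∈ s, g n ω * a n * ψ n t) ∞ m ∂P =
      ∫⁻ z, ‖∑ n : s, z n • (a n • (hψ n).toLp (ψ n))‖ₑ
        ∂(Measure.pi fun _ : s => stdComplexGaussian) := by
  rw [← hg.map_restrict s, lintegral_map' (measurable_enorm_sum_smul _).aemeasurable
    (aemeasurable_pi_lambda _ fun n : s => (hg.hasLaw n).aemeasurable)]
  refine lintegral_congr fun ω => ?_
  rw [← enorm_sum_smul_toLp s hψ, ← Finset.sum_coe_sort]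
  simp_rw [smul_smul]

theorem RandomlySidon.rademacherSidon (hg : IsComplexGaussianSequence P g)
    (hψ : BoundedInLinfty m ψ) (h : RandomlySidon P g m ψ) :
    RademacherSidon fun n => (hψ.memLp n).toLp (ψ n) := by
  obtain ⟨C, hC⟩ := h
  obtain ⟨-, B, hB⟩ := id hψ
  set Ψ : ℕ → Lp ℂ ∞ m := fun n => (hψ.memLp n).toLp (ψ n) with hΨ
  have hΨB : ∀ n, ‖Ψ n‖ ≤ B := fun n => by
    rw [hΨ, Lp.norm_toLp]
    exact ENNReal.toReal_le_coe_of_le_coe (hB n)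
  set V : ℝ := (∫⁻ z, ‖z‖ₑ ^ 2 ∂stdComplexGaussian).toReal with hV
  have hV' : ∫⁻ z, ‖z‖ₑ ^ 2 ∂stdComplexGaussian = ENNReal.ofReal V :=
    (ENNReal.ofReal_toReal lintegral_enorm_sq_stdComplexGaussian_lt_top.ne).symm
  have hV0 : 0 ≤ V := ENNReal.toReal_nonneg
  -- This level makes CBV/R at most 1/2, so the tail term is at most half of N·S and is absorbed on
  -- the left.
  set R : ℝ := 2 * C * B * V + 1 with hR
  have hRpos : 0 < R := by positivity
  refine ⟨4 * R * (C + 1), by positivity, fun s a => ?_⟩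
  set N : ℝ := (Fintype.card (s → ℤˣ) : ℝ) with hN
  set S : ℝ := ∑ n, ‖a n‖ with hS
  set W : ℝ := ∑ ε : s → ℤˣ, ‖∑ n : s, ((rad ε n : ℂ) * a n) • Ψ n‖ with hW
  have hS0 : 0 ≤ S := Finset.sum_nonneg fun _ _ => norm_nonneg _
  have hW0 : 0 ≤ W := Finset.sum_nonneg fun _ _ => norm_nonneg _
  have hN0 : 0 ≤ N := by positivity
  let a' : ℕ → ℂ := fun n => if hn : n ∈ s then a ⟨n, hn⟩ else 0
  have ha' : ∀ n : s, a' n = a n := fun n => by simp [a']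
  have h1 := hC s a'
  rw [hg.lintegral_eLpNorm hψ.memLp, ← Finset.sum_coe_sort] at h1
  simp only [ha'] at h1
  have h2 := card_mul_lintegral_gaussian_le (fun n : s => a n • Ψ n) hRpos
  have hsum : ∑ n : s, ‖a n • Ψ n‖ₑ ≤ ENNReal.ofReal (B * S) := by
    rw [hS, Finset.mul_sum, ENNReal.ofReal_sum_of_nonneg fun _ _ => by positivity]
    refine Finset.sum_le_sum fun n _ => ?_
    rw [← ofReal_norm, norm_smul, mul_comm]
    exact ENNReal.ofReal_le_ofReal (mul_le_mul_of_nonneg_right (hΨB n) (norm_nonneg _))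
  have hW' : ∑ ε : s → ℤˣ, ‖∑ n : s, (rad ε n : ℂ) • (a n • Ψ n)‖ₑ = ENNReal.ofReal W := by
    rw [hW, ENNReal.ofReal_sum_of_nonneg fun _ _ => norm_nonneg _]
    simp_rw [ofReal_norm, smul_smul]
  have hS' : ∑ n : s, ‖a n‖ₑ = ENNReal.ofReal S := by
    rw [hS, ENNReal.ofReal_sum_of_nonneg fun _ _ => norm_nonneg _]
    simp_rw [ofReal_norm]
  have hN' : (Fintype.card (s → ℤˣ) : ℝ≥0∞) = ENNReal.ofReal N := by
    rw [hN, ENNReal.ofReal_natCast]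
  rw [hW', hV', hN'] at h2
  rw [hS'] at h1
  have h3 : ENNReal.ofReal (N * S) ≤
      ENNReal.ofReal (C * (2 * R * W + N * (R⁻¹ * V * (B * S)))) := by
    rw [ENNReal.ofReal_mul hN0, ENNReal.ofReal_mul C.coe_nonneg,
      ENNReal.ofReal_add (by positivity) (by positivity),
      ENNReal.ofReal_mul (p := 2 * R) (by positivity), ENNReal.ofReal_mul hN0,
      ENNReal.ofReal_mul (p := R⁻¹ * V) (by positivity),
      ENNReal.ofReal_mul (p := R⁻¹) (by positivity)]
    refine (mul_le_mul_right h1 _).trans ?_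
    rw [mul_left_comm, show ENNReal.ofReal (C : ℝ) = C from ENNReal.ofReal_coe_nnreal]
    refine mul_le_mul_right (h2.trans ?_) _
    gcongr
  rw [ENNReal.ofReal_le_ofReal_iff (by positivity)] at h3
  have h4 : C * (N * (R⁻¹ * V * (B * S))) ≤ N * S / 2 := by
    have : C * (N * (R⁻¹ * V * (B * S))) = (C * B * V) * R⁻¹ * (N * S) := by ring
    rw [this]
    have h5 : (C * B * V) * R⁻¹ ≤ 1 / 2 := by
      rw [← div_eq_mul_inv, div_le_iff₀ hRpos, hR]; linarith
    nlinarith [mul_nonneg hN0 hS0]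
  have : 0 ≤ R * W := by positivity
  nlinarith

/-- For fixed Gaussian values z, the sign inequality is applied to the coefficients z_n a_n;
integrating gives the constant C divided by the first absolute moment c, which is positive and
finite. -/
theorem RademacherSidon.randomlySidon (hg : IsComplexGaussianSequence P g)
    (hψ : BoundedInLinfty m ψ) (h : RademacherSidon fun n => (hψ.memLp n).toLp (ψ n)) :
    RandomlySidon P g m ψ := by
  obtain ⟨C, hC0, hC⟩ := h
  set c := ∫⁻ z, ‖z‖ₑ ∂stdComplexGaussian with hc
  have hctop : c ≠ ∞ := lintegral_enorm_stdComplexGaussian_lt_top.ne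
  have hc0 : c ≠ 0 := lintegral_enorm_stdComplexGaussian_ne_zero
  refine ⟨(ENNReal.ofReal C / c).toNNReal, fun s a => ?_⟩
  rw [ENNReal.coe_toNNReal (ENNReal.div_ne_top ENNReal.ofReal_ne_top hc0),
    hg.lintegral_eLpNorm hψ.memLp, ← Finset.sum_coe_sort]
  set I := ∫⁻ z, ‖∑ n : s, z n • (a n • (hψ.memLp n).toLp (ψ n))‖ₑ
        ∂(Measure.pi fun _ : s => stdComplexGaussian) with hI
  have hN0 : (Fintype.card (s → ℤˣ) : ℝ≥0∞) ≠ 0 := by exact_mod_cast Fintype.card_ne_zero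
  have hNtop : (Fintype.card (s → ℤˣ) : ℝ≥0∞) ≠ ∞ := ENNReal.natCast_ne_top _
  have key : ∀ z : s → ℂ, (Fintype.card (s → ℤˣ) : ℝ≥0∞) * ∑ n : s, ‖z n‖ₑ * ‖a n‖ₑ ≤
      ENNReal.ofReal C * ∑ ε : s → ℤˣ,
        ‖∑ n : s, ((rad ε n : ℂ) * z n) • (a n • (hψ.memLp n).toLp (ψ n))‖ₑ := by
    intro z
    have h1 := ENNReal.ofReal_le_ofReal (hC s fun n => z n * a n)
    rw [ENNReal.ofReal_mul (by positivity), ENNReal.ofReal_mul hC0.le, ENNReal.ofReal_natCast,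
      ENNReal.ofReal_sum_of_nonneg fun _ _ => norm_nonneg _,
      ENNReal.ofReal_sum_of_nonneg fun _ _ => norm_nonneg _] at h1
    simpa only [ofReal_norm, enorm_mul, smul_smul, mul_assoc] using h1
  have h2 := lintegral_mono (μ := Measure.pi fun _ : s => stdComplexGaussian) key
  rw [lintegral_const_mul _ (by fun_prop), lintegral_finsetSum _ fun n _ => by fun_prop,
    lintegral_const_mul' _ _ ENNReal.ofReal_ne_top, ← card_mul_lintegral_gaussian, ← hI] at h2
  have h3 : ∀ n : s, ∫⁻ z : s → ℂ, ‖z n‖ₑ * ‖a n‖ₑ ∂(Measure.pi fun _ : s => stdComplexGaussian) =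
      c * ‖a n‖ₑ := fun n => by
    rw [lintegral_mul_const _ (by fun_prop),
      lintegral_eval_gaussian (f := fun z => ‖z‖ₑ) (by fun_prop) n]
  simp_rw [h3] at h2
  rw [← Finset.mul_sum, mul_left_comm (ENNReal.ofReal C),
    ENNReal.mul_le_mul_iff_right hN0 hNtop] at h2
  rw [ENNReal.div_eq_inv_mul, mul_assoc]
  calc ∑ n : s, ‖a n‖ₑ = c⁻¹ * (c * ∑ n : s, ‖a n‖ₑ) := by
        rw [← mul_assoc, ENNReal.inv_mul_cancel hc0 hctop, one_mul]
    _ ≤ _ := by gcongr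

end RandomlySidon

/-! ### Walsh expansion of the odd kernel -/

section Walsh

variable {ι : Type*}

/-- The Walsh function `∏_{n ∈ A} ε_n`. -/
def walsh (A : Finset ι) (ε : ι → ℤˣ) : ℝ := ∏ n ∈ A, rad ε n

lemma walsh_mul (A : Finset ι) (ε η : ι → ℤˣ) : walsh A (ε * η) = walsh A ε * walsh A η := by
  simp only [walsh, rad_mul, Finset.prod_mul_distrib]

lemma abs_walsh (A : Finset ι) (ε : ι → ℤˣ) : |walsh A ε| = 1 := by
  simp [walsh, Finset.abs_prod]

variable [Fintype ι]

lemma riesz_const_eq_sum (δ : ℝ) (ε : ι → ℤˣ) :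
    riesz (fun _ => δ) ε = ∑ A : Finset ι, δ ^ A.card * walsh A ε := by
  simp only [riesz, walsh]
  rw [Finset.prod_one_add, Finset.powerset_univ]
  simp [Finset.prod_mul_distrib]

/-- The kernel `(∏ (1 + δ ε_n) - ∏ (1 - δ ε_n)) / (2 δ)`, which is close to `∑ ε_n`. -/
noncomputable def oddKernel (δ : ℝ) (ε : ι → ℤˣ) : ℝ :=
  (riesz (fun _ => δ) ε - riesz (fun _ => -δ) ε) / (2 * δ)

/-- The Walsh coefficients of the remainder `oddKernel δ ε - ∑ ε_n`. -/
noncomputable def oddCoeff (δ : ℝ) (k : ℕ) : ℝ :=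
  (δ ^ k - (-δ) ^ k) / (2 * δ) - if k = 1 then 1 else 0

/-- The Walsh coefficient of a constant Riesz product at A depends only on the size of A. The odd
difference kills even degrees and is normalized to have coefficient 1 in degree one. -/
lemma oddKernel_eq (δ : ℝ) (ε : ι → ℤˣ) :
    oddKernel δ ε = ∑ n, rad ε n + ∑ A : Finset ι, oddCoeff δ A.card * walsh A ε := by
  have h1 : ∑ n, rad ε n = ∑ A : Finset ι, (if A.card = 1 then 1 else 0) * walsh A ε := by
    simp_rw [ite_mul, one_mul, zero_mul]
    rw [← Finset.sum_filter, ← Finset.powerset_univ, ← Finset.powersetCard_eq_filter,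
      Finset.powersetCard_one, Finset.sum_map]
    simp [walsh]
  rw [h1, ← Finset.sum_add_distrib, oddKernel, riesz_const_eq_sum, riesz_const_eq_sum,
    ← Finset.sum_sub_distrib, Finset.sum_div]
  refine Finset.sum_congr rfl fun A _ => ?_
  rw [oddCoeff]
  ring

variable [DecidableEq ι]

/-- At δ = 1 the Riesz product is a multiple of the point mass at the identity. -/
lemma sum_walsh (ε : ι → ℤˣ) :
    ∑ A : Finset ι, walsh A ε = if ε = 1 then (Fintype.card (ι → ℤˣ) : ℝ) else 0 := by
  have h := riesz_const_eq_sum 1 ε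
  simp only [one_pow, one_mul] at h
  rw [← h, riesz]
  split_ifs with hε
  · subst hε
    rw [card_signs]
    simp only [rad_one]
    norm_num
  · obtain ⟨n, hn⟩ := Function.ne_iff.1 hε
    refine Finset.prod_eq_zero (Finset.mem_univ n) ?_
    have : ε n = -1 := (Int.units_eq_one_or (ε n)).resolve_left hn
    simp [rad, this]

/-- Parseval's identity for Walsh functions. -/
lemma sum_normSq_walsh (X : (ι → ℤˣ) → ℂ) :
    ∑ A : Finset ι, ‖∑ ε, (walsh A ε : ℂ) * X ε‖ ^ 2 =
      Fintype.card (ι → ℤˣ) * ∑ ε, ‖X ε‖ ^ 2 := by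
  have hC : ∑ A : Finset ι, (∑ ε, (walsh A ε : ℂ) * X ε) * conj (∑ ε, (walsh A ε : ℂ) * X ε) =
      Fintype.card (ι → ℤˣ) * ∑ ε, X ε * conj (X ε) := by
    simp only [map_sum, map_mul, Complex.conj_ofReal, Finset.sum_mul_sum]
    rw [Finset.sum_comm, Finset.mul_sum]
    refine Finset.sum_congr rfl fun ε _ => ?_
    rw [Finset.sum_comm]
    have h1 : ∀ η : ι → ℤˣ, ∑ A : Finset ι, (walsh A ε : ℂ) * X ε * ((walsh A η : ℂ) * conj (X η)) =
        if η = ε then (Fintype.card (ι → ℤˣ) : ℂ) * (X ε * conj (X ε)) else 0 := by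
      intro η
      have h2 : ∀ A : Finset ι, (walsh A ε : ℂ) * X ε * ((walsh A η : ℂ) * conj (X η)) =
          ((walsh A (ε * η) : ℝ) : ℂ) * (X ε * conj (X η)) := fun A => by
        rw [walsh_mul]; push_cast; ring
      simp_rw [h2]
      rw [← Finset.sum_mul, ← Complex.ofReal_sum, sum_walsh]
      have h3 : ε * η = 1 ↔ η = ε := by
        rw [mul_eq_one_iff_eq_inv', inv_eq_of_mul_eq_one_left (mul_self_signs ε)]
      by_cases h : η = ε
      · rw [if_pos (h3.2 h), if_pos h, h]; simp
      · rw [if_neg (fun h' => h (h3.1 h')), if_neg h]; simp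
    simp_rw [h1]
    simp
  simp only [Complex.mul_conj, Complex.normSq_eq_norm_sq] at hC
  exact_mod_cast hC

/-- Both Riesz products are nonnegative with mean 1; this bound is uniform in the number of
coordinates. -/
lemma sum_abs_oddKernel_le {δ : ℝ} (hδ : 0 < δ) (hδ1 : δ ≤ 1) :
    ∑ ε : ι → ℤˣ, |oddKernel δ ε| ≤ Fintype.card (ι → ℤˣ) / δ := by
  have h1 : ∀ ε : ι → ℤˣ, |oddKernel δ ε| ≤
      (riesz (fun _ => δ) ε + riesz (fun _ => -δ) ε) / (2 * δ) := by
    intro ε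
    have hp : 0 ≤ riesz (fun _ => δ) ε :=
      riesz_nonneg (fun _ => by rw [abs_of_pos hδ]; exact hδ1) ε
    have hn : 0 ≤ riesz (fun _ => -δ) ε :=
      riesz_nonneg (fun _ => by rw [abs_neg, abs_of_pos hδ]; exact hδ1) ε
    rw [oddKernel, abs_div, abs_of_pos (by positivity : 0 < 2 * δ)]
    gcongr
    rw [abs_le]; constructor <;> linarith
  refine (Finset.sum_le_sum fun ε _ => h1 ε).trans_eq ?_
  rw [← Finset.sum_div, Finset.sum_add_distrib, sum_riesz, sum_riesz]
  field_simp
  norm_num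

/-- Even degrees and degree one vanish; an odd degree k ≥ 3 leaves δ^(k-1). -/
lemma abs_oddCoeff_le {δ : ℝ} (hδ : 0 < δ) (hδ1 : δ ≤ 1) (k : ℕ) : |oddCoeff δ k| ≤ δ ^ 2 := by
  rw [oddCoeff]
  rcases Nat.even_or_odd k with hk | hk
  · rw [hk.neg_pow, if_neg (by rintro rfl; exact absurd hk (by decide))]
    simp [sq_nonneg]
  · rw [hk.neg_pow]
    obtain ⟨j, rfl⟩ := hk
    have h1 : (δ ^ (2 * j + 1) - -δ ^ (2 * j + 1)) / (2 * δ) = (δ ^ 2) ^ j := by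
      rw [pow_succ, pow_mul]; field_simp; ring
    rw [h1]
    cases j with
    | zero => simp [sq_nonneg]
    | succ j =>
      rw [if_neg (by omega), sub_zero, abs_of_nonneg (by positivity), pow_succ]
      exact mul_le_of_le_one_left (sq_nonneg _) (pow_le_one₀ (sq_nonneg _)
        (pow_le_one₀ hδ.le hδ1))

/-- Multiplicativity of χ diagonalizes the convolution form. It is used with both the coordinate
functions and all Walsh functions. -/
lemma sum_kernel_eq {κ : Type*} [Fintype κ] (χ : κ → (ι → ℤˣ) → ℝ)
    (hχ : ∀ k ε η, χ k (ε * η) = χ k ε * χ k η) (c : κ → ℝ) (w : ι → ℤˣ) (X Y : (ι → ℤˣ) → ℂ) :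
    ∑ ε, ∑ η, ((∑ k, c k * χ k (w * (ε * η)) : ℝ) : ℂ) * (X ε * Y η) =
      ∑ k, ((c k * χ k w : ℝ) : ℂ) * ((∑ ε, (χ k ε : ℂ) * X ε) * ∑ η, (χ k η : ℂ) * Y η) := by
  simp_rw [Finset.sum_mul_sum, Finset.mul_sum, Complex.ofReal_sum, Finset.sum_mul]
  conv_lhs =>
    enter [2, ε]
    rw [Finset.sum_comm]
  rw [Finset.sum_comm]
  refine Finset.sum_congr rfl fun k _ => Finset.sum_congr rfl fun ε _ =>
    Finset.sum_congr rfl fun η _ => ?_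
  rw [hχ, hχ]
  push_cast
  ring

/-- The remainder of `oddKernel` is a small bilinear form. -/
lemma norm_sum_oddKernel_sub_le {δ D : ℝ} (hδ : 0 < δ) (hδ1 : δ ≤ 1) (w : ι → ℤˣ)
    {X Y : (ι → ℤˣ) → ℂ} (hX : ∀ ε, ‖X ε‖ ≤ D / Fintype.card (ι → ℤˣ))
    (hY : ∀ ε, ‖Y ε‖ ≤ D / Fintype.card (ι → ℤˣ)) :
    ‖∑ ε, ∑ η, (oddKernel δ (w * (ε * η)) : ℂ) * (X ε * Y η) -
      ∑ n, (rad w n : ℂ) * ((∑ ε, (rad ε n : ℂ) * X ε) * ∑ η, (rad η n : ℂ) * Y η)‖ ≤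
      δ ^ 2 * D ^ 2 := by
  set N : ℝ := (Fintype.card (ι → ℤˣ) : ℝ) with hN
  have hNpos : 0 < N := by rw [hN]; exact_mod_cast Fintype.card_pos
  have hrem : ∑ ε, ∑ η, (oddKernel δ (w * (ε * η)) : ℂ) * (X ε * Y η) -
      ∑ n, (rad w n : ℂ) * ((∑ ε, (rad ε n : ℂ) * X ε) * ∑ η, (rad η n : ℂ) * Y η) =
      ∑ A : Finset ι, ((oddCoeff δ A.card * walsh A w : ℝ) : ℂ) *
        ((∑ ε, (walsh A ε : ℂ) * X ε) * ∑ η, (walsh A η : ℂ) * Y η) := by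
    have h1 := sum_kernel_eq (fun n ε => rad ε n) (fun n ε η => rad_mul ε η n) (fun _ : ι => 1)
      w X Y
    have h2 := sum_kernel_eq walsh walsh_mul (fun A : Finset ι => oddCoeff δ A.card) w X Y
    simp only [one_mul] at h1
    rw [← h1, ← h2, ← Finset.sum_sub_distrib]
    refine Finset.sum_congr rfl fun ε _ => ?_
    rw [← Finset.sum_sub_distrib]
    refine Finset.sum_congr rfl fun η _ => ?_
    rw [oddKernel_eq, ← sub_mul, ← Complex.ofReal_sub, add_sub_cancel_left]
  rw [hrem]
  -- Parseval gives N · N · (D/N)² = D², independent of the number of indices.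
  have hbess : ∀ Z : (ι → ℤˣ) → ℂ, (∀ ε, ‖Z ε‖ ≤ D / N) →
      ∑ A : Finset ι, ‖∑ ε, (walsh A ε : ℂ) * Z ε‖ ^ 2 ≤ D ^ 2 := by
    intro Z hZ
    rw [sum_normSq_walsh]
    calc N * ∑ ε, ‖Z ε‖ ^ 2 ≤ N * ∑ _ε : ι → ℤˣ, (D / N) ^ 2 := by
          gcongr with ε
          exact hZ ε
      _ = D ^ 2 := by
          rw [Finset.sum_const, Finset.card_univ, nsmul_eq_mul, ← hN]
          field_simp
  refine (norm_sum_le _ _).trans ?_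
  calc _ ≤ ∑ A : Finset ι, δ ^ 2 * ((‖∑ ε, (walsh A ε : ℂ) * X ε‖ ^ 2 +
        ‖∑ η, (walsh A η : ℂ) * Y η‖ ^ 2) / 2) := by
        refine Finset.sum_le_sum fun A _ => ?_
        rw [norm_mul, norm_mul, Complex.norm_real, Real.norm_eq_abs, abs_mul, abs_walsh, mul_one]
        refine mul_le_mul (abs_oddCoeff_le hδ hδ1 _) ?_ (by positivity) (by positivity)
        nlinarith [sq_nonneg (‖∑ ε, (walsh A ε : ℂ) * X ε‖ - ‖∑ η, (walsh A η : ℂ) * Y η‖)]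
    _ ≤ δ ^ 2 * D ^ 2 := by
        rw [← Finset.mul_sum, ← Finset.sum_div, Finset.sum_add_distrib]
        have := hbess X hX
        have := hbess Y hY
        gcongr
        linarith

end Walsh

/-! ### Dualizing the sign inequality -/

section Duality

variable {T : Type*} [MeasurableSpace T] {m : Measure T} [IsProbabilityMeasure m]

/-- Every `y ∈ L_∞` is normed up to a factor `2` by an integrable function. -/
lemma exists_integrable_norming (y : Lp ℂ ∞ m) :
    ∃ h : T → ℂ, Integrable h m ∧ ∫ t, ‖h t‖ ∂m ≤ 1 ∧ ‖y‖ / 2 ≤ (∫ t, h t * y t ∂m).re := by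
  rcases (norm_nonneg y).eq_or_lt with h0 | hpos
  · exact ⟨0, integrable_zero _ _ _, by simp, by simp [← h0]⟩
  have hym : Measurable y := (Lp.stronglyMeasurable y).measurable
  set A : Set T := {t | ‖y‖ / 2 < ‖y t‖} with hA
  have hAm : MeasurableSet A := measurableSet_lt measurable_const hym.norm
  have hA0 : m A ≠ 0 := by
    intro h
    have h1 : ∀ᵐ t ∂m, ‖y t‖ ≤ ‖y‖ / 2 := by
      filter_upwards [measure_eq_zero_iff_ae_notMem.1 h] with t ht
      exact not_lt.1 ht
    have h2 := Lp.norm_le_of_ae_bound (p := ∞) (f := y) (by positivity) h1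
    simp at h2
    linarith
  have hmA : 0 < m.real A := ENNReal.toReal_pos hA0 (measure_ne_top m A)
  -- The conjugate phase of y, averaged over the set where ‖y t‖ exceeds half the norm.
  set h : T → ℂ := A.indicator fun t => (((m.real A)⁻¹ : ℝ) : ℂ) * (conj (y t) / ‖y t‖) with hh
  have hhm : Measurable h := by
    refine Measurable.indicator ?_ hAm
    fun_prop
  have hnorm : ∀ t, ‖h t‖ ≤ A.indicator (fun _ => (m.real A)⁻¹) t := by
    intro t
    rw [hh, norm_indicator_eq_indicator_norm]
    refine Set.indicator_le_indicator ?_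
    rw [norm_mul, norm_div, RCLike.norm_conj, Complex.norm_real, Complex.norm_real, norm_norm,
      Real.norm_of_nonneg (by positivity)]
    exact mul_le_of_le_one_right (by positivity) (div_self_le_one _)
  have hind : ∀ c : ℝ, Integrable (A.indicator fun _ => c) m := fun c =>
    (integrable_const c).indicator hAm
  have hint : Integrable h m := (hind _).mono' hhm.aestronglyMeasurable (.of_forall hnorm)
  refine ⟨h, hint, ?_, ?_⟩
  · refine (integral_mono hint.norm (hind _) hnorm).trans_eq ?_
    rw [integral_indicator_const _ hAm, smul_eq_mul, mul_inv_cancel₀ hmA.ne']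
  · have hmul : Integrable (fun t => h t * y t) m := by
      refine hint.mul_bdd (c := ‖y‖) hym.aestronglyMeasurable ?_
      filter_upwards [ae_le_eLpNormEssSup (f := y) (μ := m)] with t ht
      rw [← eLpNorm_exponent_top, ← Lp.enorm_def] at ht
      exact enorm_le_iff_norm_le.1 ht
    have hre : (∫ t, h t * y t ∂m).re = ∫ t, (h t * y t).re ∂m := (integral_re hmul).symm
    rw [hre]
    refine le_trans (le_of_eq ?_) (integral_mono (hind ((m.real A)⁻¹ * (‖y‖ / 2))) hmul.re fun t => ?_)
    · rw [integral_indicator_const _ hAm, smul_eq_mul, mul_inv_cancel_left₀ hmA.ne']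
    · by_cases ht : t ∈ A
      · have hy0 : ‖y t‖ ≠ 0 := by
          have : ‖y‖ / 2 < ‖y t‖ := ht
          linarith
        have hval : h t * y t = (((m.real A)⁻¹ * ‖y t‖ : ℝ) : ℂ) := by
          rw [hh, Set.indicator_of_mem ht, mul_assoc, div_mul_eq_mul_div, Complex.conj_mul']
          push_cast
          field_simp
        rw [Set.indicator_of_mem ht]
        simp only [hval]
        have : ‖y‖ / 2 < ‖y t‖ := ht
        change _ ≤ Complex.re _
        rw [Complex.ofReal_re]
        gcongr
      · rw [Set.indicator_of_notMem ht]
        simp [hh, Set.indicator_of_notMem ht]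

variable {ι : Type*} [Fintype ι] [DecidableEq ι]

/-- The randomly Sidon inequality for signs, in dual form. -/
lemma exists_dual_system {ψ : ι → T → ℂ} (hψ : ∀ n, MemLp (ψ n) ∞ m) {C : ℝ} (hC : 0 < C)
    (h : ∀ b : ι → ℂ, Fintype.card (ι → ℤˣ) * ∑ n, ‖b n‖ ≤
      C * ∑ ε : ι → ℤˣ, ‖∑ n, ((rad ε n : ℂ) * b n) • (hψ n).toLp (ψ n)‖) {τ : ℝ} (hτ : 0 < τ) :
    ∃ f : (ι → ℤˣ) → T → ℂ,
      (∀ ε, Integrable (f ε) m ∧ ∫ t, ‖f ε t‖ ∂m ≤ 2 * C / Fintype.card (ι → ℤˣ)) ∧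
      ∀ n, ‖∑ ε, (rad ε n : ℂ) * ∫ t, f ε t * ψ n t ∂m - 1‖ ≤ τ := by
  set N : ℝ := (Fintype.card (ι → ℤˣ) : ℝ) with hN
  have hNpos : 0 < N := by rw [hN]; exact_mod_cast Fintype.card_pos
  set D : ℝ := 2 * C / N with hD
  have hDpos : 0 < D := by positivity
  have hbd : ∀ n, ∃ c : ℝ, ∀ᵐ t ∂m, ‖ψ n t‖ ≤ c := fun n => by
    refine ⟨(eLpNorm (ψ n) ∞ m).toReal, ?_⟩
    filter_upwards [ae_le_eLpNormEssSup (f := ψ n) (μ := m)] with t ht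
    rw [← eLpNorm_exponent_top] at ht
    rw [← toReal_enorm]
    exact ENNReal.toReal_mono (hψ n).2.ne ht
  have hmul : ∀ {f : T → ℂ}, Integrable f m → ∀ n, Integrable (fun t => f t * ψ n t) m := by
    intro f hf n
    obtain ⟨c, hc⟩ := hbd n
    exact hf.mul_bdd (hψ n).1 hc
  -- The attainable vectors of diagonal coefficients. Functions in L1 only place the all-ones vector
  -- in the closure, hence the error τ.
  let K : Set (ι → ℂ) := {θ | ∃ f : (ι → ℤˣ) → T → ℂ,
    (∀ ε, Integrable (f ε) m ∧ ∫ t, ‖f ε t‖ ∂m ≤ D) ∧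
    ∀ n, θ n = ∑ ε, (rad ε n : ℂ) * ∫ t, f ε t * ψ n t ∂m}
  have hK : Convex ℝ K := by
    rintro θ ⟨f, hf, hθ⟩ θ' ⟨f', hf', hθ'⟩ a b ha hb hab
    refine ⟨fun ε t => a * f ε t + b * f' ε t, fun ε => ⟨?_, ?_⟩, fun n => ?_⟩
    · exact ((hf ε).1.const_mul _).add ((hf' ε).1.const_mul _)
    · calc ∫ t, ‖(a : ℂ) * f ε t + b * f' ε t‖ ∂m ≤ ∫ t, (a * ‖f ε t‖ + b * ‖f' ε t‖) ∂m := by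
            refine integral_mono (((hf ε).1.const_mul _).add ((hf' ε).1.const_mul _)).norm
              (((hf ε).1.norm.const_mul _).add ((hf' ε).1.norm.const_mul _)) fun t => ?_
            refine (norm_add_le _ _).trans (le_of_eq ?_)
            simp [abs_of_nonneg ha, abs_of_nonneg hb]
        _ = a * ∫ t, ‖f ε t‖ ∂m + b * ∫ t, ‖f' ε t‖ ∂m := by
            rw [integral_add ((hf ε).1.norm.const_mul _) ((hf' ε).1.norm.const_mul _),
              integral_const_mul, integral_const_mul]
        _ ≤ a * D + b * D := by
            gcongr
            exacts [(hf ε).2, (hf' ε).2]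
        _ = D := by rw [← add_mul, hab, one_mul]
    · simp only [Pi.add_apply, Pi.smul_apply, hθ, hθ', Complex.real_smul, Finset.mul_sum]
      rw [← Finset.sum_add_distrib]
      refine Finset.sum_congr rfl fun ε _ => ?_
      have : ∫ t, ((a : ℂ) * f ε t + b * f' ε t) * ψ n t ∂m =
          a * ∫ t, f ε t * ψ n t ∂m + b * ∫ t, f' ε t * ψ n t ∂m := by
        rw [← integral_const_mul, ← integral_const_mul,
          ← integral_add ((hmul (hf ε).1 n).const_mul _) ((hmul (hf' ε).1 n).const_mul _)]
        congr 1
        funext t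
        ring
      rw [this]
      ring
  -- A separating functional has coefficients b_n, and its real part at the all-ones vector is at
  -- most ∑ ‖b_n‖. Norming functions for each ε, scaled by D, give a point of K with real part at
  -- least ∑ ‖b_n‖; the 2 in D pays for the factor 2 in the norming.
  have hone : (fun _ => 1 : ι → ℂ) ∈ closure K := by
    by_contra hnot
    obtain ⟨L, u, hLu, huL⟩ := RCLike.geometric_hahn_banach_closed_point (𝕜 := ℂ)
      hK.closure isClosed_closure hnot
    let b : ι → ℂ := fun n => L (Pi.single n 1)
    have hLb : ∀ θ : ι → ℂ, L θ = ∑ n, θ n * b n := by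
      intro θ
      conv_lhs => rw [← Finset.univ_sum_single θ]
      rw [map_sum]
      refine Finset.sum_congr rfl fun n _ => ?_
      rw [show (Pi.single n (θ n) : ι → ℂ) = θ n • Pi.single n 1 by
        rw [← Pi.single_smul, smul_eq_mul, mul_one], map_smul, smul_eq_mul]
    choose f hf1 hf2 hf3 using fun ε : ι → ℤˣ =>
      exists_integrable_norming (∑ n, ((rad ε n : ℂ) * b n) • (hψ n).toLp (ψ n))
    let θ : ι → ℂ := fun n => ∑ ε, (rad ε n : ℂ) * ∫ t, ((D : ℂ) * f ε t) * ψ n t ∂m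
    have hθ : θ ∈ K := by
      refine ⟨fun ε t => D * f ε t, fun ε => ⟨(hf1 ε).const_mul _, ?_⟩, fun n => rfl⟩
      simp only [norm_mul, Complex.norm_real, Real.norm_of_nonneg hDpos.le]
      rw [integral_const_mul]
      exact mul_le_of_le_one_right hDpos.le (hf2 ε)
    have hLθ : L θ = ∑ ε : ι → ℤˣ, (D : ℂ) * ∫ t, f ε t *
        (∑ n, ((rad ε n : ℂ) * b n) • (hψ n).toLp (ψ n) : Lp ℂ ∞ m) t ∂m := by
      rw [hLb]
      simp only [θ, Finset.sum_mul]
      rw [Finset.sum_comm]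
      refine Finset.sum_congr rfl fun ε _ => ?_
      have h1 : ∫ t, f ε t * (∑ n, ((rad ε n : ℂ) * b n) • (hψ n).toLp (ψ n) : Lp ℂ ∞ m) t ∂m =
          ∫ t, ∑ n, (rad ε n : ℂ) * b n * (f ε t * ψ n t) ∂m := by
        refine integral_congr_ae ?_
        filter_upwards [coeFn_sum_smul_toLp Finset.univ hψ fun n => (rad ε n : ℂ) * b n]
          with t ht
        rw [ht, Finset.mul_sum]
        exact Finset.sum_congr rfl fun n _ => by ring
      rw [h1, integral_finsetSum _ fun n _ => (hmul (hf1 ε) n).const_mul _, Finset.mul_sum]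
      refine Finset.sum_congr rfl fun n _ => ?_
      simp_rw [mul_assoc]
      rw [integral_const_mul, integral_const_mul, integral_const_mul]
      ring
    have h1 := hLu θ (subset_closure hθ)
    have h2 : ∑ n, ‖b n‖ ≤ RCLike.re (L θ) := by
      rw [hLθ, map_sum]
      have h3 : ∑ ε : ι → ℤˣ, D * (‖∑ n, ((rad ε n : ℂ) * b n) • (hψ n).toLp (ψ n)‖ / 2) ≤
          ∑ ε : ι → ℤˣ, RCLike.re ((D : ℂ) * ∫ t, f ε t *
            (∑ n, ((rad ε n : ℂ) * b n) • (hψ n).toLp (ψ n) : Lp ℂ ∞ m) t ∂m) := by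
        refine Finset.sum_le_sum fun ε _ => ?_
        rw [RCLike.re_eq_complex_re, Complex.re_ofReal_mul]
        exact mul_le_mul_of_nonneg_left (hf3 ε) hDpos.le
      refine le_trans ?_ h3
      rw [← Finset.mul_sum, ← Finset.sum_div]
      have h4 := h b
      rw [hD, div_mul_div_comm, le_div_iff₀ (by positivity)]
      linarith
    have h3 : RCLike.re (L fun _ => 1) ≤ ∑ n, ‖b n‖ := by
      rw [hLb]
      refine (RCLike.re_le_norm _).trans ((norm_sum_le _ _).trans (le_of_eq ?_))
      simp
    linarith
  obtain ⟨θ, ⟨f, hf, hθ⟩, hdist⟩ := Metric.mem_closure_iff.1 hone τ hτ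
  refine ⟨f, hf, fun n => ?_⟩
  rw [← hθ n, ← dist_eq_norm, dist_comm]
  exact ((dist_le_pi_dist (fun _ => (1 : ℂ)) θ n).trans hdist.le)

end Duality

/-! ### Diagonal dual systems on products -/

section Tensor

variable {ι : Type*} [Fintype ι]

lemma aestronglyMeasurable_riesz {R : Type*} [MeasurableSpace R] {μ : Measure R} {c : ι → R → ℝ}
    (hc : ∀ n, AEStronglyMeasurable (c n) μ) (η : ι → ℤˣ) :
    AEStronglyMeasurable (fun r => riesz (fun n => c n r) η) μ := by
  unfold riesz
  exact Finset.aestronglyMeasurable_fun_prod _ fun n _ =>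
    aestronglyMeasurable_const.add ((hc n).mul_const _)

variable [DecidableEq ι]

/-- A kernel on the sign group whose `n`-th first order coefficient is the complex number
`c n`, for `‖c n‖ ≤ B`. -/
noncomputable def multiplierKernel (B : ℝ) (c : ι → ℂ) (η : ι → ℤˣ) : ℂ :=
  (B / Fintype.card (ι → ℤˣ) : ℝ) *
    ((riesz (fun n => (c n).re / B) η : ℂ) + (riesz (fun n => (c n).im / B) η : ℂ) * Complex.I)

lemma sum_multiplierKernel_mul_rad {B : ℝ} (hB : 0 < B) (c : ι → ℂ) (n : ι) :
    ∑ η, multiplierKernel B c η * (rad η n : ℂ) = c n := by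
  have hN : (Fintype.card (ι → ℤˣ) : ℂ) ≠ 0 := by exact_mod_cast Fintype.card_ne_zero
  have hB' : (B : ℂ) ≠ 0 := by exact_mod_cast hB.ne'
  have h1 : ∑ η : ι → ℤˣ, (riesz (fun n => (c n).re / B) η : ℂ) * (rad η n : ℂ) =
      Fintype.card (ι → ℤˣ) * ((c n).re / B) := by
    exact_mod_cast sum_riesz_mul_rad (fun n => (c n).re / B) n
  have h2 : ∑ η : ι → ℤˣ, (riesz (fun n => (c n).im / B) η : ℂ) * (rad η n : ℂ) =
      Fintype.card (ι → ℤˣ) * ((c n).im / B) := by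
    exact_mod_cast sum_riesz_mul_rad (fun n => (c n).im / B) n
  calc ∑ η, multiplierKernel B c η * (rad η n : ℂ) = (B / Fintype.card (ι → ℤˣ) : ℝ) *
        (∑ η : ι → ℤˣ, (riesz (fun n => (c n).re / B) η : ℂ) * (rad η n : ℂ) +
          (∑ η : ι → ℤˣ, (riesz (fun n => (c n).im / B) η : ℂ) * (rad η n : ℂ)) * Complex.I) := by
        rw [Finset.sum_mul, ← Finset.sum_add_distrib, Finset.mul_sum]
        refine Finset.sum_congr rfl fun η _ => ?_
        rw [multiplierKernel]
        ring
    _ = c n := by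
        rw [h1, h2]
        conv_rhs => rw [← Complex.re_add_im (c n)]
        push_cast
        field_simp

lemma sum_norm_multiplierKernel_le {B : ℝ} (hB : 0 < B) {c : ι → ℂ} (hc : ∀ n, ‖c n‖ ≤ B) :
    ∑ η, ‖multiplierKernel B c η‖ ≤ 2 * B := by
  have hNpos : 0 < (Fintype.card (ι → ℤˣ) : ℝ) := by exact_mod_cast Fintype.card_pos
  have hre : ∀ n, |(c n).re / B| ≤ 1 := fun n => by
    rw [abs_div, abs_of_pos hB, div_le_one hB]
    exact (Complex.abs_re_le_norm _).trans (hc n)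
  have him : ∀ n, |(c n).im / B| ≤ 1 := fun n => by
    rw [abs_div, abs_of_pos hB, div_le_one hB]
    exact (Complex.abs_im_le_norm _).trans (hc n)
  have h1 : ∀ η : ι → ℤˣ, ‖multiplierKernel B c η‖ ≤ B / Fintype.card (ι → ℤˣ) *
      (riesz (fun n => (c n).re / B) η + riesz (fun n => (c n).im / B) η) := by
    intro η
    rw [multiplierKernel, norm_mul, Complex.norm_real, Real.norm_of_nonneg (by positivity)]
    gcongr
    refine (norm_add_le _ _).trans (le_of_eq ?_)
    rw [norm_mul, Complex.norm_I, mul_one, Complex.norm_real, Complex.norm_real,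
      Real.norm_of_nonneg (riesz_nonneg hre η), Real.norm_of_nonneg (riesz_nonneg him η)]
  refine (Finset.sum_le_sum fun η _ => h1 η).trans_eq ?_
  rw [← Finset.mul_sum, Finset.sum_add_distrib, sum_riesz, sum_riesz]
  field_simp
  norm_num

/-- A family `H` of integrable functions indexed by signs is a dual system for `u`
if its first order coefficients are biorthogonal to `u`, up to the factors `θ`. -/
structure IsDualSystem {S : Type*} [MeasurableSpace S] (μ : Measure S) (u : ι → S → ℂ)
    (H : (ι → ℤˣ) → S → ℂ) (D B : ℝ) (θ : ι → ℂ) : Prop where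
  aesm : ∀ n, AEStronglyMeasurable (u n) μ
  bound : ∀ᵐ p ∂μ, ∀ n, ‖u n p‖ ≤ B
  integrable : ∀ ε, Integrable (H ε) μ
  norm_le : ∀ ε, ∫ p, ‖H ε p‖ ∂μ ≤ D / Fintype.card (ι → ℤˣ)
  coeff : ∀ l n, ∑ ε, (rad ε l : ℂ) * ∫ p, H ε p * u n p ∂μ = if l = n then θ n else 0

lemma aestronglyMeasurable_multiplierKernel {R : Type*} [MeasurableSpace R] {μ : Measure R}
    {Φ : ι → R → ℂ} (hΦ : ∀ n, AEStronglyMeasurable (Φ n) μ) (B : ℝ) (η : ι → ℤˣ) :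
    AEStronglyMeasurable (fun r => multiplierKernel B (fun n => Φ n r) η) μ := by
  unfold multiplierKernel
  refine AEStronglyMeasurable.const_mul (AEStronglyMeasurable.add ?_
    (AEStronglyMeasurable.mul_const ?_ _)) _
  · exact Complex.continuous_ofReal.comp_aestronglyMeasurable (aestronglyMeasurable_riesz
      (fun n => (by fun_prop : Continuous fun z : ℂ => z.re / B).comp_aestronglyMeasurable (hΦ n)) η)
  · exact Complex.continuous_ofReal.comp_aestronglyMeasurable (aestronglyMeasurable_riesz
      (fun n => (by fun_prop : Continuous fun z : ℂ => z.im / B).comp_aestronglyMeasurable (hΦ n)) η)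

/-- Tensoring with a bounded biorthogonal system makes the dual system diagonal. -/
lemma exists_isDualSystem_prod {T R : Type*} [MeasurableSpace T] [MeasurableSpace R]
    {m : Measure T} {μ : Measure R} [IsProbabilityMeasure m] [IsProbabilityMeasure μ]
    {ψ : ι → T → ℂ} {Ψ Φ : ι → R → ℂ} {B A D : ℝ} (hA : 0 < A) (hB : 0 ≤ B)
    (hψm : ∀ n, AEStronglyMeasurable (ψ n) m) (hψB : ∀ᵐ t ∂m, ∀ n, ‖ψ n t‖ ≤ B)
    (hΨm : ∀ n, AEStronglyMeasurable (Ψ n) μ) (hΨA : ∀ᵐ r ∂μ, ∀ n, ‖Ψ n r‖ ≤ A)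
    (hΦm : ∀ n, AEStronglyMeasurable (Φ n) μ) (hΦA : ∀ᵐ r ∂μ, ∀ n, ‖Φ n r‖ ≤ A)
    (hbi : ∀ l n, ∫ r, Φ l r * Ψ n r ∂μ = if l = n then 1 else 0)
    {f : (ι → ℤˣ) → T → ℂ} (hf : ∀ ε, Integrable (f ε) m)
    (hfD : ∀ ε, ∫ t, ‖f ε t‖ ∂m ≤ D / Fintype.card (ι → ℤˣ)) :
    ∃ H, IsDualSystem (m.prod μ) (fun n p => ψ n p.1 * Ψ n p.2) H (2 * A * D) (B * A)
      (fun n => ∑ ε, (rad ε n : ℂ) * ∫ t, f ε t * ψ n t ∂m) := by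
  set N : ℝ := (Fintype.card (ι → ℤˣ) : ℝ) with hN
  set κ : (ι → ℤˣ) → R → ℂ := fun η r => multiplierKernel A (fun n => Φ n r) η with hκ
  have hκsum : ∀ᵐ r ∂μ, ∑ η, ‖κ η r‖ ≤ 2 * A := by
    filter_upwards [hΦA] with r hr using sum_norm_multiplierKernel_le hA hr
  have hκint : ∀ η, Integrable (κ η) μ := fun η => by
    refine Integrable.of_bound (aestronglyMeasurable_multiplierKernel hΦm A η) (2 * A) ?_
    filter_upwards [hκsum] with r hr
    exact (Finset.single_le_sum (f := fun η => ‖κ η r‖) (fun _ _ => norm_nonneg _)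
      (Finset.mem_univ η)).trans hr
  have hterm : ∀ ε η, Integrable (fun p : T × R => f ε p.1 * κ η p.2) (m.prod μ) :=
    fun ε η => (hf ε).mul_prod (hκint η)
  have hum : ∀ n, AEStronglyMeasurable (fun p : T × R => ψ n p.1 * Ψ n p.2) (m.prod μ) :=
    fun n => (hψm n).comp_fst.mul (hΨm n).comp_snd
  have hub : ∀ᵐ p ∂m.prod μ, ∀ n, ‖ψ n p.1 * Ψ n p.2‖ ≤ B * A := by
    filter_upwards [Measure.quasiMeasurePreserving_fst.ae hψB,
      Measure.quasiMeasurePreserving_snd.ae hΨA] with p h1 h2 n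
    rw [norm_mul]
    exact mul_le_mul (h1 n) (h2 n) (norm_nonneg _) hB
  -- A convolution on the sign group: its l-th first order coefficient is that of f times Φ_l, so
  -- integration over the second variable removes every l ≠ n.
  refine ⟨fun ε p => ∑ η, f (η * ε) p.1 * κ η p.2, hum, hub,
    fun ε => integrable_finsetSum _ fun η _ => hterm _ η, fun ε => ?_, fun l n => ?_⟩
  · calc ∫ p, ‖∑ η, f (η * ε) p.1 * κ η p.2‖ ∂m.prod μ
        ≤ ∫ p, ∑ η, ‖f (η * ε) p.1‖ * ‖κ η p.2‖ ∂m.prod μ := by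
          refine integral_mono (integrable_finsetSum _ fun η _ => hterm _ η).norm
            (integrable_finsetSum _ fun η _ => (hf _).norm.mul_prod (hκint η).norm) fun p => ?_
          refine (norm_sum_le _ _).trans (le_of_eq ?_)
          simp_rw [norm_mul]
      _ = ∑ η, (∫ t, ‖f (η * ε) t‖ ∂m) * ∫ r, ‖κ η r‖ ∂μ := by
          rw [integral_finsetSum _ fun η _ => (hf _).norm.mul_prod (hκint η).norm]
          refine Finset.sum_congr rfl fun η _ => ?_
          exact integral_prod_mul (fun t => ‖f (η * ε) t‖) fun r => ‖κ η r‖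
      _ ≤ ∑ η, D / N * ∫ r, ‖κ η r‖ ∂μ := by
          gcongr with η
          exact hfD _
      _ = D / N * ∫ r, ∑ η, ‖κ η r‖ ∂μ := by
          rw [integral_finsetSum _ fun η _ => (hκint η).norm, Finset.mul_sum]
      _ ≤ D / N * (2 * A) := by
          have hD0 : 0 ≤ D / N := le_trans (integral_nonneg fun _ => norm_nonneg _) (hfD 1)
          refine mul_le_mul_of_nonneg_left ?_ hD0
          refine (integral_mono_ae (integrable_finsetSum _ fun η _ => (hκint η).norm)
            (integrable_const _) hκsum).trans_eq ?_
          simp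
      _ = 2 * A * D / N := by ring
  · have hmulint : ∀ {h : T × R → ℂ}, Integrable h (m.prod μ) →
        Integrable (fun p => h p * (ψ n p.1 * Ψ n p.2)) (m.prod μ) := fun hh =>
      hh.mul_bdd (hum n) (by filter_upwards [hub] with p hp using hp n)
    have hfψ : ∀ ε, Integrable (fun t => f ε t * ψ n t) m := fun ε =>
      (hf ε).mul_bdd (hψm n) (by filter_upwards [hψB] with t ht using ht n)
    have hptw : ∀ p : T × R, ∑ ε, (rad ε l : ℂ) * ((∑ η, f (η * ε) p.1 * κ η p.2) *
        (ψ n p.1 * Ψ n p.2)) =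
        (∑ ε, (rad ε l : ℂ) * (f ε p.1 * ψ n p.1)) * (Φ l p.2 * Ψ n p.2) := by
      intro p
      have h1 : ∑ ε, (rad ε l : ℂ) * ∑ η, f (η * ε) p.1 * κ η p.2 =
          (∑ ε, (rad ε l : ℂ) * f ε p.1) * Φ l p.2 := by
        calc ∑ ε, (rad ε l : ℂ) * ∑ η, f (η * ε) p.1 * κ η p.2
            = ∑ η, ∑ ε, κ η p.2 * (rad η l : ℂ) * ((rad (η * ε) l : ℂ) * f (η * ε) p.1) := by
              simp_rw [Finset.mul_sum]
              rw [Finset.sum_comm]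
              refine Finset.sum_congr rfl fun η _ => Finset.sum_congr rfl fun ε _ => ?_
              have h2 : ((rad η l : ℝ) : ℂ) * (rad η l : ℝ) = 1 := by
                exact_mod_cast rad_mul_self η l
              rw [rad_mul]
              push_cast
              linear_combination (-(rad ε l : ℂ) * f (η * ε) p.1 * κ η p.2) * h2
          _ = ∑ η, κ η p.2 * (rad η l : ℂ) * ∑ ε, (rad ε l : ℂ) * f ε p.1 := by
              refine Finset.sum_congr rfl fun η _ => ?_
              rw [← Finset.mul_sum, sum_mul_left_signs η fun ε => (rad ε l : ℂ) * f ε p.1]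
          _ = _ := by
              rw [← Finset.sum_mul, sum_multiplierKernel_mul_rad hA, mul_comm]
      calc _ = (∑ ε, (rad ε l : ℂ) * ∑ η, f (η * ε) p.1 * κ η p.2) * (ψ n p.1 * Ψ n p.2) := by
            rw [Finset.sum_mul]
            exact Finset.sum_congr rfl fun ε _ => by ring
        _ = _ := by
            rw [h1, Finset.sum_mul, Finset.sum_mul, Finset.sum_mul]
            exact Finset.sum_congr rfl fun ε _ => by ring
    calc _ = ∫ p, ∑ ε, (rad ε l : ℂ) * ((∑ η, f (η * ε) p.1 * κ η p.2) *
          (ψ n p.1 * Ψ n p.2)) ∂m.prod μ := by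
          rw [integral_finsetSum _ fun ε _ => (hmulint
            (integrable_finsetSum _ fun η _ => hterm (η * ε) η)).const_mul _]
          simp_rw [integral_const_mul]
      _ = (∫ t, ∑ ε, (rad ε l : ℂ) * (f ε t * ψ n t) ∂m) * ∫ r, Φ l r * Ψ n r ∂μ := by
          simp_rw [hptw]
          exact integral_prod_mul (fun t => ∑ ε, (rad ε l : ℂ) * (f ε t * ψ n t))
            fun r => Φ l r * Ψ n r
      _ = _ := by
          rw [hbi, integral_finsetSum _ fun ε _ => (hfψ ε).const_mul _]
          simp_rw [integral_const_mul]
          split_ifs with h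
          · rw [mul_one, h]
          · rw [mul_zero]

end Tensor

/-! ### Pairing two dual systems -/

section ProductSidon

lemma exists_signs_sum_abs {ι : Type*} (x : ι → ℝ) :
    ∃ w : ι → ℤˣ, ∀ n, x n * rad w n = |x n| := by
  classical
  refine ⟨fun n => if 0 ≤ x n then 1 else -1, fun n => ?_⟩
  by_cases h : 0 ≤ x n
  · simp [rad, h, abs_of_nonneg h]
  · simp [rad, h, abs_of_neg (not_le.1 h)]

lemma norm_mul_sub_one_le {θ θ' : ℂ} (h : ‖θ - 1‖ ≤ 1 / 16) (h' : ‖θ' - 1‖ ≤ 1 / 16) :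
    ‖θ * θ' - 1‖ ≤ 3 / 16 := by
  have : θ * θ' - 1 = (θ - 1) * (θ' - 1) + (θ - 1) + (θ' - 1) := by ring
  rw [this]
  refine (norm_add_le _ _).trans ?_
  have h1 := norm_add_le ((θ - 1) * (θ' - 1)) (θ - 1)
  rw [norm_mul] at h1
  nlinarith [norm_nonneg (θ - 1), norm_nonneg (θ' - 1)]

variable {ι : Type*} [Fintype ι] [DecidableEq ι] {S S' : Type*} [MeasurableSpace S]
  [MeasurableSpace S'] {μ : Measure S} {μ' : Measure S'}
  {u : ι → S → ℂ} {u' : ι → S' → ℂ} {H : (ι → ℤˣ) → S → ℂ} {H' : (ι → ℤˣ) → S' → ℂ}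
  {D B : ℝ} {θ θ' : ι → ℂ}

lemma IsDualSystem.integrable_mul (h : IsDualSystem μ u H D B θ) (ε : ι → ℤˣ) (n : ι) :
    Integrable (fun p => H ε p * u n p) μ :=
  (h.integrable ε).mul_bdd (h.aesm n) (by filter_upwards [h.bound] with p hp using hp n)

lemma IsDualSystem.norm_integral_le (h : IsDualSystem μ u H D B θ) (hB : 0 ≤ B) (ε : ι → ℤˣ)
    (n : ι) : ‖∫ p, H ε p * u n p ∂μ‖ ≤ D * B / Fintype.card (ι → ℤˣ) := by
  calc ‖∫ p, H ε p * u n p ∂μ‖ ≤ ∫ p, ‖H ε p‖ * B ∂μ := by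
        refine norm_integral_le_of_norm_le ((h.integrable ε).norm.mul_const B) ?_
        filter_upwards [h.bound] with p hp
        rw [norm_mul]
        exact mul_le_mul_of_nonneg_left (hp n) (norm_nonneg _)
    _ = (∫ p, ‖H ε p‖ ∂μ) * B := integral_mul_const _ _
    _ ≤ D / Fintype.card (ι → ℤˣ) * B := mul_le_mul_of_nonneg_right (h.norm_le ε) hB
    _ = _ := by ring

variable [SFinite μ] [SFinite μ']

/-- The signed sums of the coefficients are controlled by the sup norm on the product. -/
lemma IsDualSystem.norm_sum_signs_le (h : IsDualSystem μ u H D B θ)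
    (h' : IsDualSystem μ' u' H' D B θ') (hB : 0 ≤ B)
    (hθ : ∀ n, ‖θ n - 1‖ ≤ 1 / 16) (hθ' : ∀ n, ‖θ' n - 1‖ ≤ 1 / 16)
    {δ : ℝ} (hδ : 0 < δ) (hδ1 : δ ≤ 1) (hδB : δ * (D * B) ≤ 1 / 4) (a : ι → ℂ) {c : ℝ}
    (hc0 : 0 ≤ c)
    (hc : ∀ᵐ p ∂μ.prod μ', ‖∑ n, a n * (u n p.1 * u' n p.2)‖ ≤ c) (w : ι → ℤˣ) :
    ‖∑ n, a n * (rad w n : ℂ)‖ ≤ D ^ 2 / δ * c + 1 / 4 * ∑ n, ‖a n‖ := by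
  set N : ℝ := (Fintype.card (ι → ℤˣ) : ℝ) with hN
  have hNpos : 0 < N := by rw [hN]; exact_mod_cast Fintype.card_pos
  have hDN : 0 ≤ D / N := le_trans (integral_nonneg fun _ => norm_nonneg _) (h.norm_le 1)
  have hD : 0 ≤ D := by
    have := mul_nonneg hDN hNpos.le
    rwa [div_mul_cancel₀ _ hNpos.ne'] at this
  let X : ι → (ι → ℤˣ) → ℂ := fun n ε => ∫ p, H ε p * u n p ∂μ
  let Y : ι → (ι → ℤˣ) → ℂ := fun n ε => ∫ p, H' ε p * u' n p ∂μ'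
  let I : (ι → ℤˣ) → (ι → ℤˣ) → ℂ := fun ε η =>
    ∫ p, (H ε p.1 * H' η p.2) * ∑ n, a n * (u n p.1 * u' n p.2) ∂μ.prod μ'
  have hI : ∀ ε η, I ε η = ∑ n, a n * (X n ε * Y n η) := by
    intro ε η
    have h1 : ∀ p : S × S', (H ε p.1 * H' η p.2) * ∑ n, a n * (u n p.1 * u' n p.2) =
        ∑ n, a n * ((H ε p.1 * u n p.1) * (H' η p.2 * u' n p.2)) := fun p => by
      rw [Finset.mul_sum]
      exact Finset.sum_congr rfl fun n _ => by ring
    simp only [I, h1]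
    rw [integral_finsetSum _ fun n _ =>
      ((h.integrable_mul ε n).mul_prod (h'.integrable_mul η n)).const_mul _]
    refine Finset.sum_congr rfl fun n _ => ?_
    rw [integral_const_mul, integral_prod_mul (fun p => H ε p * u n p) fun p => H' η p * u' n p]
  have hIle : ∀ ε η, ‖I ε η‖ ≤ c * (D / N) ^ 2 := by
    intro ε η
    calc ‖I ε η‖ ≤ ∫ p, (‖H ε p.1‖ * ‖H' η p.2‖) * c ∂μ.prod μ' := by
          refine norm_integral_le_of_norm_le
            (((h.integrable ε).norm.mul_prod (h'.integrable η).norm).mul_const c) ?_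
          filter_upwards [hc] with p hp
          rw [norm_mul, norm_mul]
          exact mul_le_mul_of_nonneg_left hp (by positivity)
      _ = ((∫ p, ‖H ε p‖ ∂μ) * ∫ p, ‖H' η p‖ ∂μ') * c := by
          rw [integral_mul_const, integral_prod_mul (fun p => ‖H ε p‖) fun p => ‖H' η p‖]
      _ ≤ (D / N * (D / N)) * c := by
          refine mul_le_mul_of_nonneg_right (mul_le_mul (h.norm_le ε) (h'.norm_le η)
            (integral_nonneg fun _ => norm_nonneg _) hDN) hc0
      _ = _ := by ring
  -- Translation invariance reduces each inner sum to the mass of the kernel, and the powers of N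
  -- cancel.
  have hL : ‖∑ ε, ∑ η, (oddKernel δ (w * (ε * η)) : ℂ) * I ε η‖ ≤ D ^ 2 / δ * c := by
    calc _ ≤ ∑ ε : ι → ℤˣ, ∑ η : ι → ℤˣ, |oddKernel δ (w * (ε * η))| * (c * (D / N) ^ 2) := by
          refine (norm_sum_le _ _).trans (Finset.sum_le_sum fun ε _ => (norm_sum_le _ _).trans
            (Finset.sum_le_sum fun η _ => ?_))
          rw [norm_mul, Complex.norm_real, Real.norm_eq_abs]
          exact mul_le_mul_of_nonneg_left (hIle ε η) (abs_nonneg _)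
      _ = ∑ ε : ι → ℤˣ, (∑ η : ι → ℤˣ, |oddKernel δ η|) * (c * (D / N) ^ 2) := by
          refine Finset.sum_congr rfl fun ε _ => ?_
          rw [← Finset.sum_mul]
          congr 1
          simp_rw [← mul_assoc]
          exact sum_mul_left_signs (w * ε) fun η => |oddKernel δ η|
      _ ≤ ∑ _ε : ι → ℤˣ, (N / δ) * (c * (D / N) ^ 2) := by
          gcongr
          exact sum_abs_oddKernel_le hδ hδ1
      _ = D ^ 2 / δ * c := by
          rw [Finset.sum_const, Finset.card_univ, nsmul_eq_mul, ← hN]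
          field_simp
  have hswap : ∑ ε, ∑ η, (oddKernel δ (w * (ε * η)) : ℂ) * I ε η =
      ∑ n, a n * ∑ ε, ∑ η, (oddKernel δ (w * (ε * η)) : ℂ) * (X n ε * Y n η) := by
    simp_rw [hI, Finset.mul_sum]
    conv_lhs =>
      enter [2, ε]
      rw [Finset.sum_comm]
    rw [Finset.sum_comm]
    refine Finset.sum_congr rfl fun n _ => Finset.sum_congr rfl fun ε _ =>
      Finset.sum_congr rfl fun η _ => ?_
    ring
  -- Two errors add up to 1/4: 3/16 because θ_n θ'_n is only near 1, and 1/16 from the higher Walsh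
  -- terms.
  have hdiag : ∀ n, ‖∑ ε, ∑ η, (oddKernel δ (w * (ε * η)) : ℂ) * (X n ε * Y n η) -
      (rad w n : ℂ)‖ ≤ 1 / 4 := by
    intro n
    have h1 := norm_sum_oddKernel_sub_le hδ hδ1 w (h.norm_integral_le hB · n)
      (h'.norm_integral_le hB · n)
    have h2 : ∑ l, (rad w l : ℂ) * ((∑ ε, (rad ε l : ℂ) * ∫ p, H ε p * u n p ∂μ) *
        ∑ η, (rad η l : ℂ) * ∫ p, H' η p * u' n p ∂μ') = (rad w n : ℂ) * (θ n * θ' n) := by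
      simp_rw [h.coeff, h'.coeff]
      rw [Finset.sum_eq_single n (fun l _ hl => by simp [hl]) (by simp)]
      simp
    rw [h2] at h1
    have h3 : ‖(rad w n : ℂ) * (θ n * θ' n) - (rad w n : ℂ)‖ ≤ 3 / 16 := by
      rw [← mul_sub_one, norm_mul, Complex.norm_real, Real.norm_eq_abs, abs_rad, one_mul]
      exact norm_mul_sub_one_le (hθ n) (hθ' n)
    have h4 : δ ^ 2 * (D * B) ^ 2 ≤ 1 / 16 := by
      rw [← mul_pow]
      calc (δ * (D * B)) ^ 2 ≤ (1 / 4) ^ 2 := pow_le_pow_left₀ (by positivity) hδB 2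
        _ = 1 / 16 := by norm_num
    have h5 := norm_sub_le_norm_sub_add_norm_sub
      (∑ ε, ∑ η, (oddKernel δ (w * (ε * η)) : ℂ) * (X n ε * Y n η))
      ((rad w n : ℂ) * (θ n * θ' n)) (rad w n : ℂ)
    linarith
  have hfin : ∑ n, a n * (rad w n : ℂ) = ∑ ε, ∑ η, (oddKernel δ (w * (ε * η)) : ℂ) * I ε η -
      ∑ n, a n * (∑ ε, ∑ η, (oddKernel δ (w * (ε * η)) : ℂ) * (X n ε * Y n η) -
        (rad w n : ℂ)) := by
    rw [hswap, ← Finset.sum_sub_distrib]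
    exact Finset.sum_congr rfl fun n _ => by ring
  rw [hfin]
  refine (norm_sub_le _ _).trans (add_le_add hL ((norm_sum_le _ _).trans ?_))
  rw [Finset.mul_sum]
  refine Finset.sum_le_sum fun n _ => ?_
  rw [norm_mul, mul_comm (1 / 4 : ℝ)]
  exact mul_le_mul_of_nonneg_left (hdiag n) (norm_nonneg _)

/-- The tensor product of two systems with dual systems is Sidon. -/
lemma IsDualSystem.sum_norm_le (h : IsDualSystem μ u H D B θ)
    (h' : IsDualSystem μ' u' H' D B θ') (hB : 0 ≤ B)
    (hθ : ∀ n, ‖θ n - 1‖ ≤ 1 / 16) (hθ' : ∀ n, ‖θ' n - 1‖ ≤ 1 / 16)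
    {δ : ℝ} (hδ : 0 < δ) (hδ1 : δ ≤ 1) (hδB : δ * (D * B) ≤ 1 / 4) (a : ι → ℂ) {c : ℝ}
    (hc0 : 0 ≤ c)
    (hc : ∀ᵐ p ∂μ.prod μ', ‖∑ n, a n * (u n p.1 * u' n p.2)‖ ≤ c) :
    ∑ n, ‖a n‖ ≤ 4 * (D ^ 2 / δ) * c := by
  -- Real and imaginary parts take separate signs; the two error terms total half of ∑ ‖a n‖ and are
  -- absorbed.
  obtain ⟨w, hw⟩ := exists_signs_sum_abs fun n => (a n).re
  obtain ⟨v, hv⟩ := exists_signs_sum_abs fun n => (a n).im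
  have h1 := h.norm_sum_signs_le h' hB hθ hθ' hδ hδ1 hδB a hc0 hc w
  have h2 := h.norm_sum_signs_le h' hB hθ hθ' hδ hδ1 hδB a hc0 hc v
  have h3 : ∑ n, |(a n).re| ≤ ‖∑ n, a n * (rad w n : ℂ)‖ := by
    refine le_trans (le_of_eq ?_) (Complex.re_le_norm _)
    rw [Complex.re_sum]
    exact Finset.sum_congr rfl fun n _ => by rw [Complex.re_mul_ofReal, hw]
  have h4 : ∑ n, |(a n).im| ≤ ‖∑ n, a n * (rad v n : ℂ)‖ := by
    refine le_trans (le_of_eq ?_) ((le_abs_self _).trans (Complex.abs_im_le_norm _))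
    rw [Complex.im_sum]
    exact Finset.sum_congr rfl fun n _ => by rw [Complex.im_mul_ofReal, hv]
  have h5 : ∑ n, ‖a n‖ ≤ ∑ n, |(a n).re| + ∑ n, |(a n).im| := by
    rw [← Finset.sum_add_distrib]
    exact Finset.sum_le_sum fun n _ => Complex.norm_le_abs_re_add_abs_im _
  linarith

end ProductSidon

/-! ### From random signs to tensor powers -/

section TensorPower

lemma tensorPower_cons {T : Type*} (k : ℕ) (f : T → ℂ) (t : T) (r : Fin k → T) :
    tensorPower (k + 1) f (Fin.cons t r) = f t * tensorPower k f r := by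
  simp [tensorPower, Fin.prod_univ_succ]

variable {T : Type*} [MeasurableSpace T] {m : Measure T} [IsProbabilityMeasure m]

lemma measurePreserving_cons (k : ℕ) :
    MeasurePreserving (fun p : T × (Fin k → T) => (Fin.cons p.1 p.2 : Fin (k + 1) → T))
      (m.prod (Measure.pi fun _ => m)) (Measure.pi fun _ => m) := by
  have h := (measurePreserving_piFinSuccAbove (fun _ : Fin (k + 1) => m) 0).symm
  convert h using 1
  funext p
  simp [MeasurableEquiv.piFinSuccAbove, Fin.insertNthEquiv]

/-- The map `((a, r), (b, c)) ↦ (a, b, c, r)` is measure preserving. -/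
lemma measurePreserving_cons_cons_cons (k : ℕ) :
    MeasurePreserving (fun p : (T × (Fin k → T)) × (T × T) =>
      (Fin.cons p.1.1 (Fin.cons p.2.1 (Fin.cons p.2.2 p.1.2)) : Fin (k + 3) → T))
      ((m.prod (Measure.pi fun _ => m)).prod (m.prod m)) (Measure.pi fun _ => m) := by
  have h1 := measurePreserving_prodAssoc m (Measure.pi fun _ : Fin k => m) (m.prod m)
  have h2 : MeasurePreserving (Prod.swap : (Fin k → T) × (T × T) → (T × T) × (Fin k → T))
    ((Measure.pi fun _ => m).prod (m.prod m)) ((m.prod m).prod (Measure.pi fun _ => m)) :=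
    Measure.measurePreserving_swap
  have h3 := measurePreserving_prodAssoc m m (Measure.pi fun _ : Fin k => m)
  have h4 := (MeasurePreserving.id m).prod ((MeasurePreserving.id m).prod
    (measurePreserving_cons (m := m) k))
  have h5 := (MeasurePreserving.id m).prod (measurePreserving_cons (m := m) (k + 1))
  have h6 := measurePreserving_cons (m := m) (k + 2)
  exact h6.comp (h5.comp (h4.comp (((MeasurePreserving.id m).prod (h3.comp h2)).comp h1)))

lemma aestronglyMeasurable_tensorPower {f : T → ℂ} (hf : AEStronglyMeasurable f m) (k : ℕ) :
    AEStronglyMeasurable (tensorPower k f) (Measure.pi fun _ : Fin k => m) :=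
  Finset.aestronglyMeasurable_fun_prod _ fun j _ =>
    hf.comp_quasiMeasurePreserving (Measure.quasiMeasurePreserving_eval _ j)

lemma ae_norm_tensorPower_le {ι : Type*} {f : ι → T → ℂ} {b : ℝ}
    (hf : ∀ᵐ t ∂m, ∀ n, ‖f n t‖ ≤ b) (k : ℕ) :
    ∀ᵐ r ∂(Measure.pi fun _ : Fin k => m), ∀ n, ‖tensorPower k (f n) r‖ ≤ b ^ k := by
  have h : ∀ᵐ r ∂(Measure.pi fun _ : Fin k => m), ∀ j, ∀ n, ‖f n (r j)‖ ≤ b :=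
    Filter.eventually_all.2 fun j =>
      (Measure.quasiMeasurePreserving_eval (fun _ : Fin k => m) j).ae hf
  filter_upwards [h] with r hr n
  rw [tensorPower, norm_prod]
  refine (Finset.prod_le_prod (fun _ _ => norm_nonneg _) fun j _ => hr j n).trans ?_
  simp

/-- Systems which are randomly Sidon with respect to signs and have a bounded biorthogonal system
are tensor Sidon of every order at least `4`. -/
theorem RademacherSidon.tensorSidon {ψ φ : ℕ → T → ℂ} (hψ : BoundedInLinfty m ψ)
    (hφ : BoundedInLinfty m φ) (hbi : Biorthogonal m ψ φ)
    (h : RademacherSidon fun n => (hψ.memLp n).toLp (ψ n)) {j : ℕ} (hj : j ≠ 0) :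
    TensorSidon m (j + 3) ψ := by
  obtain ⟨C, hC0, hC⟩ := h
  obtain ⟨b₁, hb₁, hψb⟩ := hψ.exists_bound
  obtain ⟨b₂, hb₂, hφb⟩ := hφ.exists_bound
  set b := max b₁ b₂ with hb
  have hb1 : 1 ≤ b := hb₁.trans (le_max_left _ _)
  have hb0 : 0 ≤ b := by linarith
  replace hψb : ∀ᵐ t ∂m, ∀ n, ‖ψ n t‖ ≤ b := by
    filter_upwards [hψb] with t ht n using (ht n).trans (le_max_left _ _)
  have hφb' : ∀ᵐ t ∂m, ∀ n, ‖conj (φ n t)‖ ≤ b := by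
    filter_upwards [hφb] with t ht n
    rw [RCLike.norm_conj]
    exact (ht n).trans (le_max_right _ _)
  have hφm : ∀ n, AEStronglyMeasurable (fun t => conj (φ n t)) m := fun n =>
    Complex.continuous_conj.comp_aestronglyMeasurable (hφ.1 n)
  -- A common bound for the j-fold factor of the first system and the single factor of the second;
  -- the latter uses j ≠ 0.
  set A := b ^ j with hA
  have hA1 : 1 ≤ A := one_le_pow₀ hb1
  have hbA : b ≤ A := le_self_pow₀ hb1 hj
  set D := 2 * A * (2 * C) with hD
  have hD0 : 0 < D := by positivity
  set δ := 1 / (4 * (D * (b * A) + 1)) with hδ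
  have hδ0 : 0 < δ := by positivity
  have hδ1 : δ ≤ 1 := by
    rw [hδ, div_le_one (by positivity)]
    have : 0 ≤ D * (b * A) := by positivity
    linarith
  have hδB : δ * (D * (b * A)) ≤ 1 / 4 := by
    rw [hδ, div_mul_eq_mul_div, div_le_div_iff₀ (by positivity) (by norm_num)]
    linarith
  have hbi₁ : ∀ l n, ∫ t, conj (φ l t) * ψ n t ∂m = if l = n then 1 else 0 := fun l n => by
    simp_rw [mul_comm (conj _)]
    rw [hbi n l]
    simp [eq_comm]
  have hbi_j : ∀ l n, ∫ r, tensorPower j (fun t => conj (φ l t)) r * tensorPower j (ψ n) r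
      ∂(Measure.pi fun _ : Fin j => m) = if l = n then 1 else 0 := fun l n => by
    simp only [tensorPower, ← Finset.prod_mul_distrib]
    rw [integral_fintype_prod_eq_prod (fun (_ : Fin j) t => conj (φ l t) * ψ n t)]
    simp_rw [hbi₁]
    -- Off the diagonal the integral is 0^j, which vanishes because j ≠ 0.
    split_ifs <;> simp [hj]
  refine ⟨(4 * (D ^ 2 / δ)).toNNReal, fun s a => ?_⟩
  obtain ⟨f, hf, hfθ⟩ := exists_dual_system (fun n : s => hψ.memLp n) hC0 (hC s)
    (τ := 1 / 16) (by norm_num)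
  -- The j + 3 factors are grouped as (1 + j) + (1 + 1). In each group the first factor carries f
  -- and the others the biorthogonal system.
  obtain ⟨H, hH⟩ := exists_isDualSystem_prod (B := b) (A := A) (by positivity) hb0
    (fun n : s => hψ.1 n) (hψb.mono fun t ht n => ht n)
    (fun n : s => aestronglyMeasurable_tensorPower (hψ.1 n) j)
    ((ae_norm_tensorPower_le hψb j).mono fun r hr n => hr n)
    (fun n : s => aestronglyMeasurable_tensorPower (hφm n) j)
    ((ae_norm_tensorPower_le hφb' j).mono fun r hr n => hr n)
    (fun l n => by rw [hbi_j]; simp only [Subtype.coe_inj]) (fun ε => (hf ε).1) (fun ε => (hf ε).2)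
  obtain ⟨H', hH'⟩ := exists_isDualSystem_prod (B := b) (A := A) (by positivity) hb0
    (fun n : s => hψ.1 n) (hψb.mono fun t ht n => ht n)
    (fun n : s => hψ.1 n) (hψb.mono fun t ht n => (ht n).trans hbA)
    (fun n : s => hφm n) (hφb'.mono fun t ht n => (ht n).trans hbA)
    (fun l n => by rw [hbi₁]; simp only [Subtype.coe_inj]) (fun ε => (hf ε).1) (fun ε => (hf ε).2)
  set F : (Fin (j + 3) → T) → ℂ := fun t => ∑ n ∈ s, a n * tensorPower (j + 3) (ψ n) t with hF
  rcases eq_or_ne (eLpNorm F ∞ (Measure.pi fun _ : Fin (j + 3) => m)) ∞ with htop | htop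
  · have h0 : ((4 * (D ^ 2 / δ)).toNNReal : ℝ≥0∞) ≠ 0 := by
      rw [Ne, ENNReal.coe_eq_zero, Real.toNNReal_eq_zero, not_le]
      positivity
    rw [htop, ENNReal.mul_top h0]
    exact le_top
  set c := (eLpNorm F ∞ (Measure.pi fun _ : Fin (j + 3) => m)).toReal with hc
  have hae : ∀ᵐ t ∂(Measure.pi fun _ : Fin (j + 3) => m), ‖F t‖ ≤ c := by
    filter_upwards [ae_le_eLpNormEssSup (f := F) (μ := Measure.pi fun _ : Fin (j + 3) => m)]
      with t ht
    rw [← toReal_enorm]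
    exact ENNReal.toReal_mono htop ht
  have key := hH.sum_norm_le hH' (by positivity) hfθ hfθ hδ0 hδ1 hδB (fun n : s => a n)
    ENNReal.toReal_nonneg (c := c) (by
      filter_upwards [(measurePreserving_cons_cons_cons (m := m) j).quasiMeasurePreserving.ae hae]
        with p hp
      refine le_trans (le_of_eq ?_) hp
      rw [hF]
      simp only [tensorPower_cons]
      rw [← Finset.sum_coe_sort s]
      congr 1
      exact Finset.sum_congr rfl fun n _ => by ring)
  rw [Finset.sum_coe_sort s fun n => ‖a n‖] at key
  have h2 := ENNReal.ofReal_le_ofReal key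
  rw [ENNReal.ofReal_sum_of_nonneg fun _ _ => norm_nonneg _, ENNReal.ofReal_mul (by positivity),
    hc, ENNReal.ofReal_toReal htop] at h2
  simp only [ofReal_norm] at h2
  exact h2

end TensorPower

/-! ### The equivalences -/

section Main

variable {Ω : Type*} [MeasurableSpace Ω] {P : Measure Ω} [IsProbabilityMeasure P]
  {g : ℕ → Ω → ℂ} {T : Type*} [MeasurableSpace T] {m : Measure T} [IsProbabilityMeasure m]
  {ψ φ : ℕ → T → ℂ}

theorem randomlySidon_iff_tensorSidon (hg : IsComplexGaussianSequence P g)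
    (hψ : BoundedInLinfty m ψ) (hφ : BoundedInLinfty m φ) (hbi : Biorthogonal m ψ φ) :
    (RandomlySidon P g m ψ ↔ TensorSidon m 4 ψ) ∧
      (RandomlySidon P g m ψ ↔ ∃ k, 4 ≤ k ∧ TensorSidon m k ψ) ∧
      (RandomlySidon P g m ψ ↔ ∀ k, 4 ≤ k → TensorSidon m k ψ) := by
  have hto : RandomlySidon P g m ψ → ∀ k, 4 ≤ k → TensorSidon m k ψ := by
    intro h k hk
    obtain ⟨j, rfl⟩ := Nat.exists_eq_add_of_le' (show 3 ≤ k by omega)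
    exact (h.rademacherSidon hg hψ).tensorSidon hψ hφ hbi (by omega)
  have hfrom : ∀ k, 4 ≤ k → TensorSidon m k ψ → RandomlySidon P g m ψ := by
    intro k hk h
    obtain ⟨j, rfl⟩ := Nat.exists_eq_add_of_le' (show 1 ≤ k by omega)
    exact (h.rademacherSidon hψ).randomlySidon hg hψ
  exact ⟨⟨fun h => hto h 4 le_rfl, hfrom 4 le_rfl⟩,
    ⟨fun h => ⟨4, le_rfl, hto h 4 le_rfl⟩, fun ⟨k, hk, h⟩ => hfrom k hk h⟩,
    ⟨hto, fun h => hfrom 4 le_rfl (h 4 le_rfl)⟩⟩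

end Main

end SidonSystems

theorem mainTheorem4 {Ω : Type*} [MeasurableSpace Ω] (P : Measure Ω) [IsProbabilityMeasure P]
    (g : ℕ → Ω → ℂ) (hg : SidonSystems.IsComplexGaussianSequence P g)
    {T : Type*} [MeasurableSpace T] (m : Measure T) [IsProbabilityMeasure m]
    (ψ : ℕ → T → ℂ) (hψ : SidonSystems.BoundedInLinfty m ψ) :
    ((∃ φ : ℕ → T → ℂ, SidonSystems.BoundedInLinfty m φ ∧ SidonSystems.Biorthogonal m ψ φ) →
      (SidonSystems.RandomlySidon P g m ψ ↔ SidonSystems.TensorSidon m 4 ψ) ∧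
      (SidonSystems.RandomlySidon P g m ψ ↔ ∃ k, 4 ≤ k ∧ SidonSystems.TensorSidon m k ψ) ∧
      (SidonSystems.RandomlySidon P g m ψ ↔ ∀ k, 4 ≤ k → SidonSystems.TensorSidon m k ψ)) ∧
    (SidonSystems.OrthonormalSystem m ψ →
      (SidonSystems.RandomlySidon P g m ψ ↔ SidonSystems.TensorSidon m 4 ψ) ∧
      (SidonSystems.RandomlySidon P g m ψ ↔ ∃ k, 4 ≤ k ∧ SidonSystems.TensorSidon m k ψ) ∧
      (SidonSystems.RandomlySidon P g m ψ ↔ ∀ k, 4 ≤ k → SidonSystems.TensorSidon m k ψ)) := by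
  refine ⟨fun ⟨φ, hφ, hbi⟩ => SidonSystems.randomlySidon_iff_tensorSidon hg hψ hφ hbi,
    -- A bounded orthonormal system is its own bounded biorthogonal system.
    fun horth => SidonSystems.randomlySidon_iff_tensorSidon hg hψ hψ horth.2⟩
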